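/- Let $M$ be a complex manifold of complex dimension $n$ with holomorphic tangent bundle $T^{1,0}M$, and let $F:T^{1,0}M\to[0,\infty)$ be a strongly convex complex Finsler metric: $F$ is positive and $C^\infty$ outside the zero section, $F(z;\lambda v)=|\lambda|F(z;v)$ for $\lambda\in\mathbb C$, and in real coordinates $z^\alpha=x^\alpha+ix^{\alpha+n}$, $v^\alpha=y^\alpha+iy^{\alpha+n}$ the matrix $\big(\tfrac12\,\partial^2F^2/\partial y^j\partial y^k\big)_{1\le j,k\le 2n}$ is positive definite for $v\neq0$. Let $\nabla$ be the Cartan connection of $F$ (regarded as a real Finsler metric) on the real vertical bundle $\mathcal V_{\mathbb R}$ over the slit tangent bundle, and let $\mathbf J$ be the complex structure of $T^{1,0}M$; $\nabla\mathbf J=0$ means $\nabla_X(\mathbf JY)=\mathbf J(\nabla_XY)$ for all real tangent vectors $X$ of the slit bundle and all smooth local sections $Y$ of $\mathcal V_{\mathbb R}$. Put $G=F^2$, $G_{\alpha\bar\beta}=\partial^2G/\partial v^\alpha\partial\bar v^\beta$, $(G^{\bar\tau\alpha})=(G_{\beta\bar\tau})^{-1}$, and let $$\Gamma^\alpha_{;\mu}=G^{\bar\tau\alpha}\frac{\partial^2G}{\partial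 z^\mu\partial\bar v^\tau},\qquad \delta_\mu=\frac{\partial}{\partial z^\mu}-\Gamma^\alpha_{;\mu}\frac{\partial}{\partial v^\alpha},\qquad \Gamma^\alpha_{\beta;\mu}=G^{\bar\tau\alpha}\delta_\mu(G_{\beta\bar\tau})$$ be the horizontal data of the Chern–Finsler connection of $F$. Let $\Omega$ be its curvature, $\chi=v^\alpha\delta_\alpha$, and let the holomorphic sectional curvature along $v\ne0$ be $K_F(v)=\frac{2}{G(v)^2}\langle\Omega(\chi,\bar\chi)\chi,\chi\rangle_v$. Set $\mathrm{Ric}_{\mu\bar\nu}=-\sum_{\alpha}\partial\Gamma^\alpha_{\alpha;\mu}/\partial\bar z^\nu$. Suppose that $\nabla\mathbf J=0$ and that $K_F\equiv c$ for a real constant $c\neq0$. Then, in all local holomorphic coordinates and for all $v\neq0$, $$G_{\mu\bar\nu}(z;v)=\frac{4}{c(n+1)}\,\mathrm{Ric}_{\mu\bar\nu}(z;v),$$ and $G_{\mu\bar\nu}(z;v)$ does not depend on $v$. Hence $F$ is a Kähler–Einstein metric: there is a smooth Hermitian metric $h$ on $M$ with $F(v)^2=h(v,v)$ for all $v\in T^{1,0}M$,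 which is Kähler ($\partial h_{\alpha\bar\beta}/\partial z^\gamma=\partial h_{\gamma\bar\beta}/\partial z^\alpha$) and Einstein, $-\partial_\mu\partial_{\bar\nu}\log\det(h_{\alpha\bar\beta})=\frac{c(n+1)}{4}\,h_{\mu\bar\nu}$. -/

import Mathlib

open scoped Manifold ContDiff ComplexConjugate

namespace ComplexFinsler

/-- The model space of complex manifolds of complex dimension `n`. -/
abbrev Cn (n : ℕ) : Type := Fin n → ℂ

noncomputable section

/-! ### Wirtinger derivatives and real partial derivatives -/

/-- The Wirtinger derivative `½ (D_u f - i D_{iu} f)` of a complex valued function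
in the direction `u`. -/
def wirt {E : Type*} [NormedAddCommGroup E] [NormedSpace ℝ E] [Module ℂ E]
    (u : E) (f : E → ℂ) (p : E) : ℂ :=
  (1 / 2 : ℂ) * (fderiv ℝ f p u - Complex.I * fderiv ℝ f p (Complex.I • u))

/-- The conjugate Wirtinger derivative `½ (D_u f + i D_{iu} f)`. -/
def wirtBar {E : Type*} [NormedAddCommGroup E] [NormedSpace ℝ E] [Module ℂ E]
    (u : E) (f : E → ℂ) (p : E) : ℂ :=
  (1 / 2 : ℂ) * (fderiv ℝ f p u + Complex.I * fderiv ℝ f p (Complex.I • u))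

variable {n : ℕ}

/-- The coordinate vector `∂/∂z^α` of `ℂⁿ`. -/
def cvec (α : Fin n) : Cn n := Pi.single α 1

/-- `∂/∂z^α` acting on functions of `(z; v)`. -/
def dz (α : Fin n) (f : Cn n × Cn n → ℂ) : Cn n × Cn n → ℂ := wirt (cvec α, 0) f

/-- `∂/∂z̄^α` acting on functions of `(z; v)`. -/
def dzBar (α : Fin n) (f : Cn n × Cn n → ℂ) : Cn n × Cn n → ℂ := wirtBar (cvec α, 0) f

/-- `∂/∂v^α` acting on functions of `(z; v)`. -/
def dv (α : Fin n) (f : Cn n × Cn n → ℂ) : Cn n × Cn n → ℂ := wirt (0, cvec α) f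

/-- `∂/∂v̄^α` acting on functions of `(z; v)`. -/
def dvBar (α : Fin n) (f : Cn n × Cn n → ℂ) : Cn n × Cn n → ℂ := wirtBar (0, cvec α) f

/-- Index set of the real coordinates: `Sum.inl α` is the index `α`, and `Sum.inr α` is the
index `α* = α + n`. -/
abbrev RIdx (n : ℕ) : Type := Fin n ⊕ Fin n

/-- The real coordinate vectors of `ℂⁿ`: `e_α` and `e_{α*} = i e_α`. -/
def rvec : RIdx n → Cn n
  | Sum.inl α => cvec α
  | Sum.inr α => Complex.I • cvec α

/-- The real coordinates of a vector of `ℂⁿ`: `v^α = y^α + i y^{α*}`. -/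
def rcoord : RIdx n → Cn n → ℝ
  | Sum.inl α, v => (v α).re
  | Sum.inr α, v => (v α).im

/-- `∂/∂x^j` acting on real functions of `(x; y)`. -/
def dx (j : RIdx n) (f : Cn n × Cn n → ℝ) (p : Cn n × Cn n) : ℝ := fderiv ℝ f p (rvec j, 0)

/-- `∂/∂y^j` acting on real functions of `(x; y)`. -/
def dy (j : RIdx n) (f : Cn n × Cn n → ℝ) (p : Cn n × Cn n) : ℝ := fderiv ℝ f p (0, rvec j)

/-! ### Real Finsler geometry in coordinates

`G` is the function `F²` written in the coordinates `(z; v)`, which are at the same time the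
real coordinates `(x; y)` through `z^α = x^α + i x^{α*}`, `v^α = y^α + i y^{α*}`. -/

/-- The real fundamental tensor `g_{jk} = ½ ∂²F²/∂y^j∂y^k`. -/
def realMetric (G : Cn n × Cn n → ℝ) (p : Cn n × Cn n) : Matrix (RIdx n) (RIdx n) ℝ :=
  Matrix.of fun j k => (1 / 2 : ℝ) * dy j (dy k G) p

/-- The real geodesic spray coefficients
`Ĝ^k = ¼ g^{kl} (∂²F²/∂x^a∂y^l y^a - ∂F²/∂x^l)`. -/
def spray (G : Cn n × Cn n → ℝ) (k : RIdx n) (p : Cn n × Cn n) : ℝ :=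
  (1 / 4 : ℝ) * ∑ l, (realMetric G p)⁻¹ k l *
    ((∑ a, dx a (dy l G) p * rcoord a p.2) - dx l G p)

/-- The real non-linear connection coefficients `Γ̂^k_j = ∂Ĝ^k/∂y^j`. -/
def realNonlinear (G : Cn n × Cn n → ℝ) (k j : RIdx n) (p : Cn n × Cn n) : ℝ :=
  dy j (spray G k) p

/-- The real horizontal derivative `δ/δx^j = ∂/∂x^j - Γ̂^k_j ∂/∂y^k`. -/
def realDelta (G : Cn n × Cn n → ℝ) (j : RIdx n) (f : Cn n × Cn n → ℝ)
    (p : Cn n × Cn n) : ℝ :=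
  dx j f p - ∑ k, realNonlinear G k j p * dy k f p

/-- The horizontal coefficients `Γ̂^k_{j;l}` of the Cartan connection. -/
def cartanHor (G : Cn n × Cn n → ℝ) (k j l : RIdx n) (p : Cn n × Cn n) : ℝ :=
  ∑ s, (1 / 2 : ℝ) * (realMetric G p)⁻¹ k s *
    (realDelta G l (fun q => realMetric G q s j) p
      - realDelta G s (fun q => realMetric G q j l) p
      + realDelta G j (fun q => realMetric G q l s) p)

/-- The vertical coefficients `Γ̂^k_{jl} = ¼ g^{ks} ∂³F²/∂y^j∂y^l∂y^s` of the Cartan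
connection. -/
def cartanVert (G : Cn n × Cn n → ℝ) (k j l : RIdx n) (p : Cn n × Cn n) : ℝ :=
  (1 / 4 : ℝ) * ∑ s, (realMetric G p)⁻¹ k s * dy j (dy l (dy s G)) p

/-- The coframe `δy^l = dy^l + Γ̂^l_k dx^k`, evaluated on a real tangent vector
`X = (X.1, X.2)` at the point `p = (z; v)`. -/
def deltaY (G : Cn n × Cn n → ℝ) (l : RIdx n) (p X : Cn n × Cn n) : ℝ :=
  rcoord l X.2 + ∑ k, realNonlinear G l k p * rcoord k X.1

/-- The connection forms `ω̂_j^k = Γ̂^k_{j;l} dx^l + Γ̂^k_{jl} δy^l` of the Cartan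
connection, evaluated on a real tangent vector `X` at the point `p = (z; v)`. -/
def cartanForm (G : Cn n × Cn n → ℝ) (j k : RIdx n) (p X : Cn n × Cn n) : ℝ :=
  (∑ l, cartanHor G k j l p * rcoord l X.1) + ∑ l, cartanVert G k j l p * deltaY G l p X

/-- The Cartan covariant derivative `∇_X Y` at `p` of a real vertical field
`Y = Y^k ∂/∂y^k`, given by its components `Y p k`. -/
def cartanDeriv (G : Cn n × Cn n → ℝ) (X : Cn n × Cn n) (Y : Cn n × Cn n → RIdx n → ℝ)
    (p : Cn n × Cn n) : RIdx n → ℝ :=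
  fun k => fderiv ℝ (fun q => Y q k) p X + ∑ j, Y p j * cartanForm G j k p X

/-- The complex structure `𝐉` of the total space acting on real vertical vectors:
`𝐉 ∂/∂y^α = ∂/∂y^{α*}` and `𝐉 ∂/∂y^{α*} = -∂/∂y^α`. -/
def vertJ (Y : RIdx n → ℝ) : RIdx n → ℝ
  | Sum.inl α => -Y (Sum.inr α)
  | Sum.inr α => Y (Sum.inl α)

/-! ### Complex Finsler geometry in coordinates -/

/-- `F²` regarded as a complex valued function. -/
def toC (G : Cn n × Cn n → ℝ) (p : Cn n × Cn n) : ℂ := (G p : ℂ)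

/-- The complex fundamental tensor `G_{αβ̄} = ∂²F²/∂v^α∂v̄^β`. -/
def cMetric (G : Cn n × Cn n → ℝ) (p : Cn n × Cn n) : Matrix (Fin n) (Fin n) ℂ :=
  Matrix.of fun α β => dv α (dvBar β (toC G)) p

/-- The complex non-linear connection coefficients
`Γ^α_{;μ} = G^{τ̄α} ∂²F²/∂z^μ∂v̄^τ`, where `G_{βτ̄} G^{τ̄α} = δ_β^α`. -/
def chernNonlinear (G : Cn n × Cn n → ℝ) (α μ : Fin n) (p : Cn n × Cn n) : ℂ :=
  ∑ τ, (cMetric G p)⁻¹ τ α * dz μ (dvBar τ (toC G)) p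

/-- `δ_μ = ∂/∂z^μ - Γ^α_{;μ} ∂/∂v^α`. -/
def chernDelta (G : Cn n × Cn n → ℝ) (μ : Fin n) (f : Cn n × Cn n → ℂ)
    (p : Cn n × Cn n) : ℂ :=
  dz μ f p - ∑ α, chernNonlinear G α μ p * dv α f p

/-- The conjugate `δ_{ν̄}` of `δ_ν`. -/
def chernDeltaBar (G : Cn n × Cn n → ℝ) (ν : Fin n) (f : Cn n × Cn n → ℂ)
    (p : Cn n × Cn n) : ℂ :=
  dzBar ν f p - ∑ α, conj (chernNonlinear G α ν p) * dvBar α f p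

/-- The horizontal coefficients `Γ^α_{β;μ} = G^{τ̄α} δ_μ(G_{βτ̄})` of the Chern-Finsler
connection. -/
def chernHor (G : Cn n × Cn n → ℝ) (α β μ : Fin n) (p : Cn n × Cn n) : ℂ :=
  ∑ τ, (cMetric G p)⁻¹ τ α * chernDelta G μ (fun q => cMetric G q β τ) p

/-- The vertical coefficients `Γ^α_{βγ} = G^{τ̄α} ∂G_{βτ̄}/∂v^γ` of the Chern-Finsler
connection. -/
def chernVert (G : Cn n × Cn n → ℝ) (α β γ : Fin n) (p : Cn n × Cn n) : ℂ :=
  ∑ τ, (cMetric G p)⁻¹ τ α * dv γ (fun q => cMetric G q β τ) p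

/-- The coefficient of `dz^μ ∧ dz̄^ν` (in the coframe `dz, ψ` and conjugates) of the
curvature form `Ω_β^α = dω_β^α - ω_β^γ ∧ ω_γ^α` of the Chern-Finsler connection:
`-δ_{ν̄}(Γ^α_{β;μ}) - Γ^α_{βσ} δ_{ν̄}(Γ^σ_{;μ})`. -/
def chernCurv (G : Cn n × Cn n → ℝ) (α β μ ν : Fin n) (p : Cn n × Cn n) : ℂ :=
  -chernDeltaBar G ν (chernHor G α β μ) p
    - ∑ σ, chernVert G α β σ p * chernDeltaBar G ν (chernNonlinear G σ μ) p

/-- The holomorphic sectional curvature `(2 / G²) ⟨Ω(χ, χ̄)χ, χ⟩_v` at `p = (z; v)`, where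
`χ = v^α δ_α`. -/
def holSecCurv (G : Cn n × Cn n → ℝ) (p : Cn n × Cn n) : ℂ :=
  2 / (toC G p) ^ 2 * ∑ α, ∑ β, ∑ μ, ∑ ν, ∑ γ,
    cMetric G p α γ * chernCurv G α β μ ν p * p.2 β * p.2 μ * conj (p.2 ν) * conj (p.2 γ)

/-- The Ricci tensor `Ric_{μν̄} = -∑_α ∂Γ^α_{α;μ}/∂z̄^ν`. -/
def ricci (G : Cn n × Cn n → ℝ) (μ ν : Fin n) (p : Cn n × Cn n) : ℂ :=
  ∑ α, -dzBar ν (chernHor G α α μ) p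

/-! ### Finsler metrics on complex manifolds -/

variable {M : Type*} [TopologicalSpace M] [ChartedSpace (Cn n) M]

/-- The holomorphic charts of the complex manifold `M`. -/
def holCharts (n : ℕ) (M : Type*) [TopologicalSpace M] [ChartedSpace (Cn n) M] :
    Set (OpenPartialHomeomorph M (Cn n)) :=
  IsManifold.maximalAtlas 𝓘(ℂ, Cn n) ω M

/-- The holomorphic tangent vector `v^α ∂/∂z^α` at the point with coordinates `z`, for the
chart `φ`. -/
def tvec (φ : OpenPartialHomeomorph M (Cn n)) (z v : Cn n) :
    TangentSpace 𝓘(ℂ, Cn n) (φ.symm z) :=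
  mfderiv 𝓘(ℂ, Cn n) 𝓘(ℂ, Cn n) φ.symm z v

/-- `F` written in the holomorphic coordinates `(z; v)` induced by the chart `φ`. -/
def localF (F : TangentBundle 𝓘(ℂ, Cn n) M → ℝ) (φ : OpenPartialHomeomorph M (Cn n))
    (p : Cn n × Cn n) : ℝ :=
  F ⟨φ.symm p.1, tvec φ p.1 p.2⟩

/-- `G = F²` written in the holomorphic coordinates `(z; v)` induced by the chart `φ`. -/
def localG (F : TangentBundle 𝓘(ℂ, Cn n) M → ℝ) (φ : OpenPartialHomeomorph M (Cn n))
    (p : Cn n × Cn n) : ℝ :=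
  localF F φ p ^ 2

/-- The coordinate domain of the slit tangent bundle `T^{1,0}M ∖ {0}` over the chart `φ`. -/
def slit (φ : OpenPartialHomeomorph M (Cn n)) : Set (Cn n × Cn n) :=
  φ.target ×ˢ {v | v ≠ 0}

/-- A strongly convex complex Finsler metric. The holomorphic tangent bundle `T^{1,0}M` is the
tangent bundle of `M` as a complex manifold. -/
structure IsStronglyConvexFinsler (F : TangentBundle 𝓘(ℂ, Cn n) M → ℝ) : Prop where
  nonneg : ∀ w, 0 ≤ F w
  pos : ∀ (p : M) (v : TangentSpace 𝓘(ℂ, Cn n) p), v ≠ 0 → 0 < F ⟨p, v⟩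
  smooth : ∀ φ ∈ holCharts n M, ContDiffOn ℝ ∞ (localF F φ) (slit φ)
  homogeneous : ∀ (p : M) (v : TangentSpace 𝓘(ℂ, Cn n) p) (a : ℂ),
    F ⟨p, a • v⟩ = ‖a‖ * F ⟨p, v⟩
  strongly_convex : ∀ φ ∈ holCharts n M, ∀ p ∈ slit φ, (realMetric (localG F φ) p).PosDef

/-- `∇𝐉 = 0` for the Cartan connection `∇` of `F`: `∇_X(𝐉Y) = 𝐉(∇_X Y)` for all real tangent
vectors `X` of the slit tangent bundle and all smooth (local) real vertical fields `Y`. -/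
def CartanParallelJ (F : TangentBundle 𝓘(ℂ, Cn n) M → ℝ) : Prop :=
  ∀ φ ∈ holCharts n M, ∀ p ∈ slit φ, ∀ (X : Cn n × Cn n) (Y : Cn n × Cn n → RIdx n → ℝ),
    ContDiffAt ℝ ∞ Y p →
      cartanDeriv (localG F φ) X (fun q => vertJ (Y q)) p
        = vertJ (cartanDeriv (localG F φ) X Y p)

/-- `F` has constant holomorphic sectional curvature `c`. -/
def HasConstHolSecCurv (F : TangentBundle 𝓘(ℂ, Cn n) M → ℝ) (c : ℝ) : Prop :=
  ∀ φ ∈ holCharts n M, ∀ p ∈ slit φ, holSecCurv (localG F φ) p = (c : ℂ)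

/-! ### Hermitian metrics -/

/-- The components `h_{αβ̄}` in the chart `φ` of a family of pairings on the holomorphic tangent
spaces. -/
def hermComp (h : ∀ p : M, TangentSpace 𝓘(ℂ, Cn n) p → TangentSpace 𝓘(ℂ, Cn n) p → ℂ)
    (φ : OpenPartialHomeomorph M (Cn n)) (z : Cn n) : Matrix (Fin n) (Fin n) ℂ :=
  Matrix.of fun α β => h (φ.symm z) (tvec φ z (cvec α)) (tvec φ z (cvec β))

/-- A smooth Hermitian metric on the complex manifold `M`. -/
structure IsHermitianMetric
    (h : ∀ p : M, TangentSpace 𝓘(ℂ, Cn n) p → TangentSpace 𝓘(ℂ, Cn n) p → ℂ) : Prop where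
  add_left : ∀ p v v' w, h p (v + v') w = h p v w + h p v' w
  smul_left : ∀ (p : M) (a : ℂ) (v w : TangentSpace 𝓘(ℂ, Cn n) p),
    h p (a • v) w = a * h p v w
  conj_symm : ∀ p v w, conj (h p v w) = h p w v
  pos : ∀ (p : M) (v : TangentSpace 𝓘(ℂ, Cn n) p), v ≠ 0 → 0 < (h p v v).re
  smooth : ∀ φ ∈ holCharts n M, ∀ α β,
    ContDiffOn ℝ ∞ (fun z => hermComp h φ z α β) φ.target

/-- The Kähler condition `dω = 0` for `ω = i h_{αβ̄} dz^α ∧ dz̄^β`, in coordinates: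
`∂h_{αβ̄}/∂z^γ = ∂h_{γβ̄}/∂z^α`. -/
def IsKahler (h : ∀ p : M, TangentSpace 𝓘(ℂ, Cn n) p → TangentSpace 𝓘(ℂ, Cn n) p → ℂ) :
    Prop :=
  ∀ φ ∈ holCharts n M, ∀ z ∈ φ.target, ∀ α β γ : Fin n,
    wirt (cvec γ) (fun x => hermComp h φ x α β) z
      = wirt (cvec α) (fun x => hermComp h φ x γ β) z

/-- The components `-∂²/∂z^μ∂z̄^ν log det (h_{αβ̄})` of the Ricci curvature of a Kähler
metric. -/
def hermRicci (h : ∀ p : M, TangentSpace 𝓘(ℂ, Cn n) p → TangentSpace 𝓘(ℂ, Cn n) p → ℂ)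
    (φ : OpenPartialHomeomorph M (Cn n)) (μ ν : Fin n) (z : Cn n) : ℂ :=
  -wirt (cvec μ)
    (wirtBar (cvec ν) (fun x => ((Real.log (hermComp h φ x).det.re : ℝ) : ℂ))) z

/-- The Einstein condition `Ric = k h` with Einstein constant `k`. -/
def IsEinstein (h : ∀ p : M, TangentSpace 𝓘(ℂ, Cn n) p → TangentSpace 𝓘(ℂ, Cn n) p → ℂ)
    (k : ℝ) : Prop :=
  ∀ φ ∈ holCharts n M, ∀ z ∈ φ.target, ∀ μ ν : Fin n,
    hermRicci h φ μ ν z = (k : ℂ) * hermComp h φ z μ ν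

/-- `F` is a Kähler-Einstein metric with Einstein constant `k`: `F² (v) = h(v, v)` for a
Hermitian metric `h` that is Kähler and Einstein. -/
def IsKahlerEinstein (F : TangentBundle 𝓘(ℂ, Cn n) M → ℝ) (k : ℝ) : Prop :=
  ∃ h : ∀ p : M, TangentSpace 𝓘(ℂ, Cn n) p → TangentSpace 𝓘(ℂ, Cn n) p → ℂ,
    IsHermitianMetric h ∧
    (∀ (p : M) (v : TangentSpace 𝓘(ℂ, Cn n) p), ((F ⟨p, v⟩ ^ 2 : ℝ) : ℂ) = h p v v) ∧
    IsKahler h ∧ IsEinstein h k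

end

end ComplexFinsler

/-! The condition `∇𝐉 = 0` makes `F²` quadratic on each fibre; what remains is Kähler geometry.

Vertical directions: the Cartan tensor of `G = F²` vanishes when one slot is `v`, by homogeneity.
Commuting with `𝐉`, it also vanishes when a slot is `iv`. Since `G` is homogeneous under complex
scalars, Euler's identity for the field `iv` turns this into skewness of the fibre Hessian under `i`
(`second_skew`), hence its invariance. Differentiating once more, a totally symmetric trilinear form
changes sign each time `i` passes from one slot to another; three passages bring `i` back to its
slot with sign `-1`, so the form is zero (`third_vert`). The punctured fibre is connected, so the
Hessian is constant there and `G` is the quadratic form of a Hermitian form `h` (`exists_invForm`),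
recovered from `G` by polarization.

Horizontal directions: the Cartan coefficients are now the Christoffel symbols of the real part of
`h`, so `∇𝐉 = 0` says that the Levi-Civita connection commutes with the complex structure, which is
the Kähler condition (`kahler_wirtBar`).

Curvature: the Chern–Finsler data reduce to those of the Chern connection of `h`. The Kähler
curvature tensor is symmetric in its two holomorphic and in its two antiholomorphic indices, so its
values on the diagonal determine it (`coeff_eq_zero_of_biquadratic`). Constant curvature `c` forces
it to be `c/4` times the symmetrized product of `h` with itself, and its trace is `c(n+1)/4 · h`
(`ricci_of_constHolSecCurv`). Jacobi's formula identifies this trace with `-∂∂̄ log det h`. -/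

namespace ComplexFinsler

/-! ### Calculus of iterated directional derivatives -/

section DirectionalDerivatives

variable {E F : Type*} [NormedAddCommGroup E] [NormedSpace ℝ E] [NormedAddCommGroup F]
  [NormedSpace ℝ F] {f : E → F} {s : Set E} {p : E}

lemma contDiffOn_dirDeriv (hs : IsOpen s) (hf : ContDiffOn ℝ ∞ f s) (u : E) :
    ContDiffOn ℝ ∞ (fun q => fderiv ℝ f q u) s :=
  (hf.fderiv_of_isOpen hs (m := ∞) (by simp)).clm_apply contDiffOn_const

lemma differentiableAt_of_contDiffOn (hs : IsOpen s) (hf : ContDiffOn ℝ ∞ f s) (hp : p ∈ s) :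
    DifferentiableAt ℝ f p :=
  (hf.contDiffAt (hs.mem_nhds hp)).differentiableAt (by simp)

lemma differentiableAt_fderiv_of_contDiffOn (hs : IsOpen s) (hf : ContDiffOn ℝ ∞ f s)
    (hp : p ∈ s) : DifferentiableAt ℝ (fderiv ℝ f) p :=
  differentiableAt_of_contDiffOn hs (hf.fderiv_of_isOpen hs (m := ∞) (by simp)) hp

lemma fderiv_dirDeriv (hs : IsOpen s) (hf : ContDiffOn ℝ ∞ f s) (hp : p ∈ s) (u w : E) :
    fderiv ℝ (fun q => fderiv ℝ f q u) p w = fderiv ℝ (fderiv ℝ f) p w u := by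
  rw [fderiv_clm_apply (differentiableAt_fderiv_of_contDiffOn hs hf hp)
    (differentiableAt_const u)]
  simp

lemma dirDeriv_comm (hs : IsOpen s) (hf : ContDiffOn ℝ ∞ f s) (hp : p ∈ s) (u w : E) :
    fderiv ℝ (fun q => fderiv ℝ f q u) p w = fderiv ℝ (fun q => fderiv ℝ f q w) p u := by
  rw [fderiv_dirDeriv hs hf hp, fderiv_dirDeriv hs hf hp]
  exact ((hf.contDiffAt (hs.mem_nhds hp)).isSymmSndFDerivAt
    (by simpa using WithTop.coe_le_coe.2 (le_top : (2 : ℕ∞) ≤ ⊤))).eq w u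

lemma fderiv_congr_on {g : E → F} (hs : IsOpen s) (h : ∀ q ∈ s, f q = g q) (hp : p ∈ s) :
    fderiv ℝ f p = fderiv ℝ g p :=
  Filter.EventuallyEq.fderiv_eq (Filter.eventuallyEq_of_mem (hs.mem_nhds hp) h)

/-- Differentiating the identity `D f (L q) = r q` once more. -/
lemma dirDeriv_linear_field (hs : IsOpen s) (hf : ContDiffOn ℝ ∞ f s) (L : E →L[ℝ] E) (r : E → F)
    (h : ∀ q ∈ s, fderiv ℝ f q (L q) = r q) (hp : p ∈ s) (a : E) :
    fderiv ℝ (fun q => fderiv ℝ f q a) p (L p) = fderiv ℝ r p a - fderiv ℝ f p (L a) := by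
  rw [← fderiv_congr_on hs h hp, fderiv_clm_apply
    (differentiableAt_fderiv_of_contDiffOn hs hf hp) L.differentiableAt, dirDeriv_comm hs hf hp,
    fderiv_dirDeriv hs hf hp]
  simp

end DirectionalDerivatives

/-! ### The local setting and real fibre coordinates -/

variable {n : ℕ}

/-- A function `G` on `U × ℂⁿ` with the properties of the local expression of the square of a
strongly convex complex Finsler metric whose Cartan connection commutes with `𝐉`. -/
structure LocalFinsler (G : Cn n × Cn n → ℝ) (U : Set (Cn n)) : Prop where
  isOpen : IsOpen U
  smooth : ContDiffOn ℝ ∞ G (U ×ˢ {v | v ≠ 0})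
  homogeneous : ∀ z ∈ U, ∀ (v : Cn n) (a : ℂ), G (z, a • v) = ‖a‖ ^ 2 * G (z, v)
  pos : ∀ z ∈ U, ∀ v : Cn n, v ≠ 0 → 0 < G (z, v)
  posDef : ∀ p ∈ U ×ˢ {v : Cn n | v ≠ 0}, (realMetric G p).PosDef
  parallel : ∀ p ∈ U ×ˢ {v : Cn n | v ≠ 0}, ∀ (X : Cn n × Cn n) (Y : RIdx n → ℝ),
    cartanDeriv G X (fun _ => vertJ Y) p = vertJ (cartanDeriv G X (fun _ => Y) p)

lemma sum_rcoord_smul_rvec (w : Cn n) : ∑ j, rcoord j w • rvec j = w := by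
  rw [Fintype.sum_sum_type]
  ext α
  simp only [rcoord, rvec, cvec, Pi.add_apply, Finset.sum_apply, Pi.smul_apply, Pi.single_apply]
  simp

lemma rcoord_rvec (j k : RIdx n) : rcoord j (rvec k) = if j = k then 1 else 0 := by
  rcases j with j | j <;> rcases k with k | k <;> simp [rcoord, rvec, cvec, Pi.single_apply] <;>
  split_ifs <;> simp

lemma vertJ_rcoord (v : Cn n) : vertJ (fun j => rcoord j v) = fun j => rcoord j (Complex.I • v) := by
  funext j
  rcases j with j | j <;> simp [vertJ, rcoord]

lemma sum_rcoord_mul_fderiv {f : Cn n × Cn n → ℝ} (p : Cn n × Cn n) (w : Cn n) :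
    ∑ j, rcoord j w * fderiv ℝ f p (0, rvec j) = fderiv ℝ f p (0, w) := by
  have : ((0 : Cn n), w) = ∑ j, rcoord j w • ((0 : Cn n), rvec j) := by
    conv_lhs => rw [← sum_rcoord_smul_rvec w]
    simp [Prod.ext_iff, Prod.fst_sum, Prod.snd_sum]
  rw [this, map_sum]
  simp only [map_smul, smul_eq_mul]

/-- The real linear vector field `(z; v) ↦ (0, c v)`. -/
noncomputable def vertField (c : ℂ) : Cn n × Cn n →L[ℝ] Cn n × Cn n :=
  (ContinuousLinearMap.inr ℝ (Cn n) (Cn n)).comp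
    (c • ContinuousLinearMap.snd ℝ (Cn n) (Cn n))

@[simp] lemma vertField_apply (c : ℂ) (p : Cn n × Cn n) : vertField c p = (0, c • p.2) := rfl

/-! ### Euler identities and the radial Cartan tensor -/

namespace LocalFinsler

variable {G : Cn n × Cn n → ℝ} {U : Set (Cn n)}

lemma isOpen_slit (h : LocalFinsler G U) : IsOpen (U ×ˢ {v : Cn n | v ≠ 0}) :=
  h.isOpen.prod isOpen_ne

/-- Along the real line `t ↦ (1 + tc)v` the function is `|1 + tc|² G`, whose derivative at `0` is `2
Re(c) G`. The case `c = 1` is the classical identity; `c = i` expresses invariance under rotations.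
-/
lemma euler (h : LocalFinsler G U) (c : ℂ) {p : Cn n × Cn n} (hp : p ∈ U ×ˢ {v : Cn n | v ≠ 0}) :
    fderiv ℝ G p (vertField c p) = 2 * c.re * G p := by
  have h1 := (differentiableAt_of_contDiffOn h.isOpen_slit h.smooth hp).hasFDerivAt.hasLineDerivAt
    (vertField c p)
  have h2 : (fun t : ℝ => G (p + t • vertField c p))
      = fun t : ℝ => ((1 + t * c.re) ^ 2 + (t * c.im) ^ 2) * G p := by
    funext t
    have : p + t • vertField c p = (p.1, (1 + t * c) • p.2) := by
      ext i <;> simp [add_mul, mul_assoc]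
    rw [this, h.homogeneous _ hp.1, ← Complex.normSq_eq_norm_sq, Complex.normSq_apply]
    simp [sq]
  rw [HasLineDerivAt, h2] at h1
  have h3 : HasDerivAt (fun t : ℝ => ((1 + t * c.re) ^ 2 + (t * c.im) ^ 2) * G p)
      (2 * c.re * G p) 0 := by
    have e1 : HasDerivAt (fun t : ℝ => 1 + t * c.re) c.re 0 := by
      simpa using ((hasDerivAt_id (0 : ℝ)).mul_const c.re).const_add 1
    have e2 : HasDerivAt (fun t : ℝ => t * c.im) c.im 0 := by
      simpa using ((hasDerivAt_id (0 : ℝ)).mul_const c.im)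
    have := ((e1.pow 2).add (e2.pow 2)).mul_const (G p)
    simpa using this
  exact h1.unique h3

lemma smooth_second (h : LocalFinsler G U) (a b : Cn n × Cn n) :
    ContDiffOn ℝ ∞ (fun q => fderiv ℝ (fun q' => fderiv ℝ G q' a) q b)
      (U ×ˢ {v : Cn n | v ≠ 0}) :=
  contDiffOn_dirDeriv h.isOpen_slit (contDiffOn_dirDeriv h.isOpen_slit h.smooth a) b

lemma euler_one (h : LocalFinsler G U) (c : ℂ) {p : Cn n × Cn n}
    (hp : p ∈ U ×ˢ {v : Cn n | v ≠ 0}) (a : Cn n × Cn n) :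
    fderiv ℝ (fun q => fderiv ℝ G q a) p (vertField c p)
      = 2 * c.re * fderiv ℝ G p a - fderiv ℝ G p (vertField c a) := by
  rw [dirDeriv_linear_field h.isOpen_slit h.smooth (vertField c) _ (fun q hq => h.euler c hq) hp]
  rw [fderiv_const_mul (differentiableAt_of_contDiffOn h.isOpen_slit h.smooth hp)]
  simp

lemma euler_two (h : LocalFinsler G U) (c : ℂ) {p : Cn n × Cn n}
    (hp : p ∈ U ×ˢ {v : Cn n | v ≠ 0}) (a b : Cn n × Cn n) :
    fderiv ℝ (fun q => fderiv ℝ (fun q' => fderiv ℝ G q' a) q b) p (vertField c p)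
      = 2 * c.re * fderiv ℝ (fun q => fderiv ℝ G q a) p b
        - fderiv ℝ (fun q => fderiv ℝ G q (vertField c a)) p b
        - fderiv ℝ (fun q => fderiv ℝ G q a) p (vertField c b) := by
  have hs := fun u => contDiffOn_dirDeriv h.isOpen_slit h.smooth u
  have hd := fun u => differentiableAt_of_contDiffOn h.isOpen_slit (hs u) hp
  rw [dirDeriv_linear_field h.isOpen_slit (hs a) (vertField c) _
    (fun q hq => h.euler_one c hq a) hp, fderiv_fun_sub ((hd a).const_mul _) (hd _),
    fderiv_const_mul (hd a)]
  simp

/-- The vertical part of `∇𝐉 = 0`: the third derivatives vanish in the direction `i v`. -/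
lemma third_radial_rvec (h : LocalFinsler G U) {p : Cn n × Cn n}
    (hp : p ∈ U ×ˢ {v : Cn n | v ≠ 0}) (l s : RIdx n) :
    fderiv ℝ (dy l (dy s G)) p (vertField Complex.I p) = 0 := by
  -- For a vertical coordinate vector and constant components, only the vertical coefficients of the
  -- connection survive.
  have key : ∀ Y : RIdx n → ℝ, cartanDeriv G (0, rvec l) (fun _ => Y) p
      = (4⁻¹ : ℝ) • ((realMetric G p)⁻¹).mulVec
          (fun s => ∑ j, Y j * dy j (dy l (dy s G)) p) := by
    intro Y
    funext k
    have h0 : ∀ j : RIdx n, rcoord j (0 : Cn n) = 0 := by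
      rintro (j | j) <;> simp [rcoord]
    simp only [cartanDeriv, cartanForm, deltaY, h0, rcoord_rvec, cartanVert]
    simp only [fderiv_fun_const, mul_zero, Finset.sum_const_zero, add_zero, zero_add, mul_ite,
      mul_one, Finset.sum_ite_eq', Finset.mem_univ, if_true, Pi.zero_apply,
      _root_.zero_apply, Pi.smul_apply, smul_eq_mul, Matrix.mulVec, dotProduct,
      Finset.mul_sum]
    rw [Finset.sum_comm]
    refine Finset.sum_congr rfl fun s _ => Finset.sum_congr rfl fun j _ => ?_
    ring
  -- The field is the radial vector frozen at `p`: the covariant derivative is zero for it by Euler,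
  -- and `𝐉` carries it to `iv`.
  have h1 := h.parallel p hp (0, rvec l) (fun j => rcoord j p.2)
  rw [key, key, vertJ_rcoord] at h1
  have hd : ∀ (j : RIdx n) (f : Cn n × Cn n → ℝ), dy j f = fun q => fderiv ℝ f q (0, rvec j) :=
    fun _ _ => rfl
  simp only [hd, sum_rcoord_mul_fderiv] at h1
  have hz : ∀ s : RIdx n, fderiv ℝ (fun q => fderiv ℝ (fun q' => fderiv ℝ G q' (0, rvec s)) q
      (0, rvec l)) p (0, p.2) = 0 := by
    intro s
    have := h.euler_two 1 hp (0, rvec s) (0, rvec l)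
    simp only [vertField_apply, one_smul, Complex.one_re] at this
    rw [this]; ring
  rw [show (fun s : RIdx n => fderiv ℝ (fun q => fderiv ℝ (fun q' => fderiv ℝ G q' (0, rvec s)) q
      (0, rvec l)) p (0, p.2)) = 0
    from funext hz] at h1
  have h2 : vertJ ((4⁻¹ : ℝ) • ((realMetric G p)⁻¹).mulVec (0 : RIdx n → ℝ)) = 0 := by
    funext k
    rcases k with k | k <;> simp [vertJ]
  rw [h2] at h1
  have h3 := (smul_eq_zero.mp h1).resolve_left (by norm_num)
  have hdet : IsUnit (realMetric G p).det := (h.posDef p hp).det_pos.ne'.isUnit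
  have h4 := congrArg (realMetric G p).mulVec h3
  rw [Matrix.mulVec_mulVec, Matrix.mul_nonsing_inv _ hdet, Matrix.one_mulVec,
    Matrix.mulVec_zero] at h4
  exact congrFun h4 s

end LocalFinsler

/-- A real symmetric bilinear form which is invariant under multiplication by `i`. -/
structure IsInvForm {V : Type*} [AddCommGroup V] [Module ℂ V] (b : V → V → ℝ) : Prop where
  add_left : ∀ u u' w, b (u + u') w = b u w + b u' w
  smul_left : ∀ (t : ℝ) u w, b ((t : ℂ) • u) w = t * b u w
  symm : ∀ u w, b u w = b w u
  inv : ∀ u w, b (Complex.I • u) (Complex.I • w) = b u w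

/-! ### Vanishing of the Cartan tensor; `G` is quadratic on fibres -/

namespace LocalFinsler

variable {G : Cn n × Cn n → ℝ} {U : Set (Cn n)}

lemma third_swap_left (h : LocalFinsler G U) {p : Cn n × Cn n}
    (hp : p ∈ U ×ˢ {v : Cn n | v ≠ 0}) (a b c : Cn n × Cn n) :
    fderiv ℝ (fun q => fderiv ℝ (fun q' => fderiv ℝ G q' a) q b) p c
      = fderiv ℝ (fun q => fderiv ℝ (fun q' => fderiv ℝ G q' a) q c) p b :=
  dirDeriv_comm h.isOpen_slit (contDiffOn_dirDeriv h.isOpen_slit h.smooth a) hp b c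

lemma third_swap_right (h : LocalFinsler G U) {p : Cn n × Cn n}
    (hp : p ∈ U ×ˢ {v : Cn n | v ≠ 0}) (a b c : Cn n × Cn n) :
    fderiv ℝ (fun q => fderiv ℝ (fun q' => fderiv ℝ G q' a) q b) p c
      = fderiv ℝ (fun q => fderiv ℝ (fun q' => fderiv ℝ G q' b) q a) p c := by
  rw [fderiv_congr_on h.isOpen_slit (fun q hq => dirDeriv_comm h.isOpen_slit h.smooth hq a b) hp]

/-- Extension of `third_radial_rvec` from coordinate vectors to arbitrary ones: a slot is expanded
in the real basis once it has been swapped into the outermost position, where linearity is manifest.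
-/
lemma third_radial (h : LocalFinsler G U) {p : Cn n × Cn n}
    (hp : p ∈ U ×ˢ {v : Cn n | v ≠ 0}) (a b : Cn n) :
    fderiv ℝ (fun q => fderiv ℝ (fun q' => fderiv ℝ G q' (0, a)) q (0, b)) p
      (vertField Complex.I p) = 0 := by
  have h1 : ∀ (s : RIdx n) (b : Cn n), fderiv ℝ (fun q => fderiv ℝ (fun q' =>
      fderiv ℝ G q' (0, rvec s)) q (0, b)) p (vertField Complex.I p) = 0 := by
    intro s b
    rw [h.third_swap_left hp, ← sum_rcoord_mul_fderiv]
    refine Finset.sum_eq_zero fun l _ => ?_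
    rw [h.third_swap_left hp]
    exact mul_eq_zero_of_right _ (h.third_radial_rvec hp l s)
  rw [h.third_swap_right hp, h.third_swap_left hp, ← sum_rcoord_mul_fderiv]
  refine Finset.sum_eq_zero fun l _ => ?_
  rw [h.third_swap_left hp, h.third_swap_right hp, h1, mul_zero]

/-- Euler's identity of second order for the field `iv`: its left side is zero by `third_radial`,
and the term with `Re i` drops out. -/
lemma second_skew (h : LocalFinsler G U) {p : Cn n × Cn n}
    (hp : p ∈ U ×ˢ {v : Cn n | v ≠ 0}) (a b : Cn n) :
    fderiv ℝ (fun q => fderiv ℝ G q (0, a)) p (0, Complex.I • b)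
      = -fderiv ℝ (fun q => fderiv ℝ G q (0, Complex.I • a)) p (0, b) := by
  have := h.euler_two Complex.I hp (0, a) (0, b)
  rw [h.third_radial hp] at this
  simp only [vertField_apply, Complex.I_re] at this
  linarith

lemma second_inv (h : LocalFinsler G U) {p : Cn n × Cn n}
    (hp : p ∈ U ×ˢ {v : Cn n | v ≠ 0}) (a b : Cn n) :
    fderiv ℝ (fun q => fderiv ℝ G q (0, Complex.I • a)) p (0, Complex.I • b)
      = fderiv ℝ (fun q => fderiv ℝ G q (0, a)) p (0, b) := by
  have h2 : ((0 : Cn n), -b) = -((0 : Cn n), b) := by simp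
  have := h.second_skew hp a (Complex.I • b)
  rw [smul_smul, Complex.I_mul_I, neg_one_smul, h2, map_neg] at this
  linarith

/-- Differentiating `second_skew` shows that moving `i` between two slots changes the sign. By total
symmetry `i` can be moved around all three slots and back, which gives `T = -T`. -/
lemma third_vert (h : LocalFinsler G U) {p : Cn n × Cn n}
    (hp : p ∈ U ×ˢ {v : Cn n | v ≠ 0}) (a b c : Cn n) :
    fderiv ℝ (fun q => fderiv ℝ (fun q' => fderiv ℝ G q' (0, a)) q (0, b)) p (0, c) = 0 := by
  have hskew : ∀ a b c : Cn n,
      fderiv ℝ (fun q => fderiv ℝ (fun q' => fderiv ℝ G q' (0, a)) q (0, Complex.I • b)) p (0, c)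
      = -fderiv ℝ (fun q => fderiv ℝ (fun q' => fderiv ℝ G q' (0, Complex.I • a)) q (0, b)) p
        (0, c) := by
    intro a b c
    rw [fderiv_congr_on h.isOpen_slit (fun q hq => h.second_skew hq a b) hp, fderiv_fun_neg]
    simp
  have hl := h.third_swap_left hp
  have hr := h.third_swap_right hp
  have h0 : ∀ a b c : Cn n, fderiv ℝ (fun q => fderiv ℝ (fun q' => fderiv ℝ G q' (0, a)) q
      (0, b)) p (0, Complex.I • c) = 0 := by
    intro a b c
    -- The three `e`s are the three sign changes around the cycle of slots; the `f`s only reorder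
    -- derivatives so that equal quantities appear in equal form.
    have e1 := hskew a c b
    have e2 := hskew c b a
    have e3 := hskew b a c
    have f1 := hl (0, a) (0, b) (0, Complex.I • c)
    have f2 := hr (0, Complex.I • a) (0, c) (0, b)
    have f3 := hl (0, c) (0, Complex.I • a) (0, b)
    have f4 := hr (0, Complex.I • c) (0, b) (0, a)
    have f5 := hl (0, b) (0, Complex.I • c) (0, a)
    have f6 := hl (0, c) (0, Complex.I • b) (0, a)
    have f7 := hr (0, c) (0, a) (0, Complex.I • b)
    have f8 := hl (0, a) (0, c) (0, Complex.I • b)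
    have f9 := hr (0, b) (0, Complex.I • a) (0, c)
    have f10 := hl (0, c) (0, b) (0, Complex.I • a)
    have f11 := hr (0, c) (0, b) (0, Complex.I • a)
    have f12 := hl (0, b) (0, c) (0, Complex.I • a)
    have f13 := hr (0, b) (0, a) (0, Complex.I • c)
    have f14 := hl (0, b) (0, a) (0, Complex.I • c)
    have f15 := hr (0, Complex.I • b) (0, a) (0, c)
    linarith
  -- Every vector is `i` times another one: `i · (-(i c)) = c`.
  have := h0 a b (-(Complex.I • c))
  rwa [smul_neg, smul_smul, Complex.I_mul_I, neg_one_smul, neg_neg] at this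

lemma second_const (h : LocalFinsler G U) {z : Cn n} (hz : z ∈ U) {v w : Cn n} (hv : v ≠ 0)
    (hw : w ≠ 0) (a b : Cn n) :
    fderiv ℝ (fun q => fderiv ℝ G q (0, a)) (z, v) (0, b)
      = fderiv ℝ (fun q => fderiv ℝ G q (0, a)) (z, w) (0, b) := by
  -- The punctured fibre is connected because its real dimension `2n` exceeds one; `n = 0` is
  -- excluded by the nonzero `v`.
  have hrank : 1 < Module.rank ℝ (Cn n) := by
    have hn : 0 < n := by
      rcases Nat.eq_zero_or_pos n with rfl | hn
      · exact absurd (Subsingleton.elim v 0) hv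
      · exact hn
    rw [← Module.finrank_eq_rank, Module.finrank_pi_fintype]
    simp only [Complex.finrank_real_complex, Finset.sum_const, Finset.card_univ, Fintype.card_fin,
      smul_eq_mul]
    exact_mod_cast (by omega : 1 < n * 2)
  have hconn := (isConnected_compl_singleton_of_one_lt_rank hrank (0 : Cn n)).isPreconnected
  have hd : ∀ u : Cn n, u ≠ 0 → HasFDerivAt
      (fun u : Cn n => fderiv ℝ (fun q => fderiv ℝ G q (0, a)) (z, u) (0, b))
      ((fderiv ℝ (fun q => fderiv ℝ (fun q' => fderiv ℝ G q' (0, a)) q (0, b)) (z, u)).comp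
        (ContinuousLinearMap.inr ℝ (Cn n) (Cn n))) u := by
    intro u hu
    exact (differentiableAt_of_contDiffOn h.isOpen_slit (h.smooth_second (0, a) (0, b))
      (p := (z, u)) ⟨hz, hu⟩).hasFDerivAt.comp u (hasFDerivAt_prodMk_right z u)
  refine isOpen_ne.is_const_of_fderiv_eq_zero (𝕜 := ℝ) (s := {u : Cn n | u ≠ 0}) hconn
    (f := fun u : Cn n => fderiv ℝ (fun q => fderiv ℝ G q (0, a)) (z, u) (0, b))
    (fun u hu => (hd u hu).differentiableAt.differentiableWithinAt) (fun u hu => ?_) hv hw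
  rw [(hd u hu).fderiv]
  ext c
  exact h.third_vert (p := (z, u)) ⟨hz, hu⟩ a b c

lemma apply_zero (h : LocalFinsler G U) {z : Cn n} (hz : z ∈ U) : G (z, 0) = 0 := by
  simpa using h.homogeneous z hz 0 0

/-- On each fibre, `G` is the quadratic form of an invariant bilinear form. -/
lemma exists_invForm (h : LocalFinsler G U) {z : Cn n} (hz : z ∈ U) :
    ∃ b : Cn n → Cn n → ℝ, IsInvForm b ∧ (∀ v, G (z, v) = b v v) ∧
      ∀ v, v ≠ 0 → ∀ a c,
        fderiv ℝ (fun q => fderiv ℝ G q (0, a)) (z, v) (0, c) = 2 * b a c := by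
  by_cases hn : ∃ v : Cn n, v ≠ 0
  · obtain ⟨v, hv⟩ := hn
    have hp : (z, v) ∈ U ×ˢ {v : Cn n | v ≠ 0} := ⟨hz, hv⟩
    have hsymm : ∀ a c : Cn n, fderiv ℝ (fun q => fderiv ℝ G q (0, a)) (z, v) (0, c)
        = fderiv ℝ (fun q => fderiv ℝ G q (0, c)) (z, v) (0, a) :=
      fun a c => dirDeriv_comm h.isOpen_slit h.smooth hp _ _
    -- The form is half the fibre Hessian at an arbitrary nonzero point; by `second_const` the
    -- choice is immaterial.
    refine ⟨fun a c => (1 / 2) * fderiv ℝ (fun q => fderiv ℝ G q (0, a)) (z, v) (0, c),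
      ⟨fun u u' w => ?_, fun t u w => ?_, fun u w => ?_, fun u w => ?_⟩, fun w => ?_,
      fun w hw a c => ?_⟩
    · rw [hsymm, hsymm u, hsymm u',
        show ((0 : Cn n), u + u') = (0, u) + (0, u') by simp, map_add]
      ring
    · rw [hsymm, hsymm u,
        show ((0 : Cn n), (t : ℂ) • u) = t • ((0 : Cn n), u) by
          simp [Complex.coe_smul], map_smul, smul_eq_mul]
      ring
    · rw [hsymm]
    · rw [h.second_inv hp]
    · beta_reduce
      by_cases hw : w = 0
      · rw [hw, h.apply_zero hz, show ((0 : Cn n), (0 : Cn n)) = 0 from rfl, map_zero, mul_zero]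
      · have hq : (z, w) ∈ U ×ˢ {v : Cn n | v ≠ 0} := ⟨hz, hw⟩
        have e1 := h.euler_one 1 hq (0, w)
        have e2 := h.euler 1 hq
        simp only [vertField_apply, one_smul, Complex.one_re] at e1 e2
        rw [h.second_const hz hv hw, e1, e2]
        ring
    · rw [h.second_const hz hw hv]
      ring
  -- A fibre without nonzero vectors (`n = 0`), where the zero form works.
  · push Not at hn
    refine ⟨fun _ _ => 0, ⟨by simp, by simp, by simp, by simp⟩, fun v => ?_, fun v hv => ?_⟩
    · rw [hn v, h.apply_zero hz]
    · exact absurd (hn v) hv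

end LocalFinsler

/-! ### Polarization -/

/-- The sesquilinear form obtained from a quadratic form by polarization. -/
noncomputable def pol {V : Type*} [AddCommGroup V] [Module ℂ V] (Q : V → ℝ) (u w : V) : ℂ :=
  (((1 / 4) * (Q (u + w) - Q (u - w)) : ℝ) : ℂ)
    + (((1 / 4) * (Q (u + Complex.I • w) - Q (u - Complex.I • w)) : ℝ) : ℂ) * Complex.I

section Polarization

variable {V : Type*} [AddCommGroup V] [Module ℂ V] {b : V → V → ℝ} {Q : V → ℝ}

namespace IsInvForm

lemma add_right (hb : IsInvForm b) (u w w' : V) : b u (w + w') = b u w + b u w' := by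
  rw [hb.symm, hb.add_left, hb.symm w, hb.symm w']

lemma neg_left (hb : IsInvForm b) (u w : V) : b (-u) w = -b u w := by
  simpa using hb.smul_left (-1) u w

lemma neg_right (hb : IsInvForm b) (u w : V) : b u (-w) = -b u w := by
  rw [hb.symm, hb.neg_left, hb.symm]

lemma I_left (hb : IsInvForm b) (u w : V) : b (Complex.I • u) w = -b u (Complex.I • w) := by
  have := hb.inv u (Complex.I • w)
  rw [smul_smul, Complex.I_mul_I, neg_one_smul, hb.neg_right] at this
  linarith

/-- The parallelogram differences give `b(u, w) + i b(u, iw)`; with `b` invariant under `i` this is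
linear in `u` and conjugate linear in `w`. -/
lemma pol_eq (hb : IsInvForm b) (hQ : ∀ v, Q v = b v v) (u w : V) :
    pol Q u w = b u w + b u (Complex.I • w) * Complex.I := by
  simp only [pol, hQ, sub_eq_add_neg, hb.add_left, hb.add_right, hb.neg_left, hb.neg_right]
  rw [hb.symm w u, hb.symm (Complex.I • w) u]
  congr 3 <;> ring

lemma pol_add_left (hb : IsInvForm b) (hQ : ∀ v, Q v = b v v) (u u' w : V) :
    pol Q (u + u') w = pol Q u w + pol Q u' w := by
  simp only [hb.pol_eq hQ, hb.add_left]
  push_cast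
  ring

lemma pol_smul_left (hb : IsInvForm b) (hQ : ∀ v, Q v = b v v) (a : ℂ) (u w : V) :
    pol Q (a • u) w = a * pol Q u w := by
  have h1 : ∀ (t : ℝ) (u : V), pol Q ((t : ℂ) • u) w = t * pol Q u w := by
    intro t u
    simp only [hb.pol_eq hQ, hb.smul_left]
    push_cast
    ring
  have h2 : ∀ u : V, pol Q (Complex.I • u) w = Complex.I * pol Q u w := by
    intro u
    simp only [hb.pol_eq hQ, hb.inv, hb.I_left u w]
    push_cast
    linear_combination (-(b u (Complex.I • w) : ℂ)) * Complex.I_sq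
  conv_lhs => rw [← Complex.re_add_im a, add_smul, hb.pol_add_left hQ, mul_comm, mul_smul, h1, h2,
    h1]
  conv_rhs => rw [← Complex.re_add_im a]
  ring

lemma pol_conj (hb : IsInvForm b) (hQ : ∀ v, Q v = b v v) (u w : V) :
    conj (pol Q u w) = pol Q w u := by
  simp only [hb.pol_eq hQ, map_add, map_mul, Complex.conj_ofReal, Complex.conj_I]
  rw [hb.symm w u, hb.symm w, hb.I_left]
  push_cast
  ring

lemma pol_self (hb : IsInvForm b) (hQ : ∀ v, Q v = b v v) (v : V) : pol Q v v = Q v := by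
  have h1 : b v (Complex.I • v) = 0 := by
    have := hb.I_left v v
    rw [hb.symm] at this
    linarith
  rw [hb.pol_eq hQ, h1, hQ]
  simp

end IsInvForm

lemma IsInvForm.pol_eq_sum {b : Cn n → Cn n → ℝ} {Q : Cn n → ℝ} (hb : IsInvForm b)
    (hQ : ∀ v, Q v = b v v) (u w : Cn n) :
    pol Q u w = ∑ α, ∑ β, pol Q (cvec α) (cvec β) * u α * conj (w β) := by
  have hl : ∀ u w : Cn n, pol Q u w = ∑ α, u α * pol Q (cvec α) w := by
    intro u w
    let L : Cn n →ₗ[ℂ] ℂ :=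
      { toFun := fun u => pol Q u w
        map_add' := fun u u' => hb.pol_add_left hQ u u' w
        map_smul' := fun a u => hb.pol_smul_left hQ a u w }
    have := L.pi_apply_eq_sum_univ u
    have hc : ∀ α : Fin n, (fun j => if α = j then (1 : ℂ) else 0) = cvec α := by
      intro α
      ext j
      simp [cvec, Pi.single_apply, eq_comm]
    simpa only [L, hc, LinearMap.coe_mk, AddHom.coe_mk, smul_eq_mul] using this
  rw [hl u w]
  refine Finset.sum_congr rfl fun α _ => ?_
  rw [← hb.pol_conj hQ, hl w, map_sum, Finset.mul_sum]
  refine Finset.sum_congr rfl fun β _ => ?_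
  rw [map_mul, hb.pol_conj hQ]
  ring

end Polarization

/-! ### Wirtinger calculus -/

section Wirtinger

lemma fderiv_re_add_im {E : Type*} [NormedAddCommGroup E] [NormedSpace ℝ E] {f g : E → ℝ} {p : E}
    (hf : DifferentiableAt ℝ f p) (hg : DifferentiableAt ℝ g p) (u : E) :
    fderiv ℝ (fun q => (f q : ℂ) + (g q : ℂ) * Complex.I) p u
      = (fderiv ℝ f p u : ℂ) + (fderiv ℝ g p u : ℂ) * Complex.I := by
  have h1 : HasFDerivAt (fun q => (f q : ℂ)) (Complex.ofRealCLM.comp (fderiv ℝ f p)) p :=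
    Complex.ofRealCLM.hasFDerivAt.comp p hf.hasFDerivAt
  have h2 : HasFDerivAt (fun q => (g q : ℂ)) (Complex.ofRealCLM.comp (fderiv ℝ g p)) p :=
    Complex.ofRealCLM.hasFDerivAt.comp p hg.hasFDerivAt
  rw [(h1.fun_add (h2.mul_const Complex.I)).fderiv]
  simp [mul_comm]

lemma fderiv_conj {E : Type*} [NormedAddCommGroup E] [NormedSpace ℝ E] (f : E → ℂ) (p u : E) :
    fderiv ℝ (fun q => conj (f q)) p u = conj (fderiv ℝ f p u) := by
  have : (fun q => conj (f q)) = Complex.conjCLE ∘ f := rfl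
  rw [this, ContinuousLinearEquiv.comp_fderiv]
  simp

variable {E : Type*} [NormedAddCommGroup E] [NormedSpace ℝ E] [Module ℂ E]
  {f g : E → ℂ} {s : Set E} {p : E}

lemma wirt_congr_on (hs : IsOpen s) (h : ∀ q ∈ s, f q = g q) (hp : p ∈ s) (u : E) :
    wirt u f p = wirt u g p := by
  rw [wirt, wirt, fderiv_congr_on hs h hp]

lemma wirtBar_congr_on (hs : IsOpen s) (h : ∀ q ∈ s, f q = g q) (hp : p ∈ s) (u : E) :
    wirtBar u f p = wirtBar u g p := by
  rw [wirtBar, wirtBar, fderiv_congr_on hs h hp]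

lemma conj_wirtBar (f : E → ℂ) (p u : E) :
    conj (wirtBar u f p) = wirt u (fun q => conj (f q)) p := by
  simp only [wirt, wirtBar, fderiv_conj, map_mul, map_add, Complex.conj_I, map_div₀, map_one,
    map_ofNat]
  ring

lemma wirtBar_mul (hf : DifferentiableAt ℝ f p) (hg : DifferentiableAt ℝ g p) (u : E) :
    wirtBar u (fun q => f q * g q) p = wirtBar u f p * g p + f p * wirtBar u g p := by
  simp only [wirtBar, fderiv_fun_mul hf hg, _root_.add_apply, _root_.smul_apply, smul_eq_mul]
  ring

lemma wirtBar_sum {ι : Type*} (t : Finset ι) {f : ι → E → ℂ}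
    (hf : ∀ i ∈ t, DifferentiableAt ℝ (f i) p) (u : E) :
    wirtBar u (fun q => ∑ i ∈ t, f i q) p = ∑ i ∈ t, wirtBar u (f i) p := by
  simp only [wirtBar, fderiv_fun_sum hf, _root_.sum_apply, Finset.mul_sum,
    ← Finset.sum_add_distrib]

lemma contDiffOn_wirt (hs : IsOpen s) (hf : ContDiffOn ℝ ∞ f s) (u : E) :
    ContDiffOn ℝ ∞ (wirt u f) s :=
  contDiffOn_const.mul ((contDiffOn_dirDeriv hs hf u).sub
    (contDiffOn_const.mul (contDiffOn_dirDeriv hs hf (Complex.I • u))))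

lemma wirt_wirtBar_comm (hs : IsOpen s) (hf : ContDiffOn ℝ ∞ f s) (hp : p ∈ s) (u w : E) :
    wirt u (wirtBar w f) p = wirtBar w (wirt u f) p := by
  have hd := fun a => differentiableAt_of_contDiffOn hs (contDiffOn_dirDeriv hs hf a) hp
  have h1 : ∀ a, fderiv ℝ (wirtBar w f) p a = (1 / 2 : ℂ) * (fderiv ℝ (fun q => fderiv ℝ f q w) p a
      + Complex.I * fderiv ℝ (fun q => fderiv ℝ f q (Complex.I • w)) p a) := by
    intro a
    change fderiv ℝ (fun q => (1 / 2 : ℂ) * (fderiv ℝ f q w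
      + Complex.I * fderiv ℝ f q (Complex.I • w))) p a = _
    rw [fderiv_const_mul ((hd _).fun_add ((hd _).const_mul _)), fderiv_fun_add (hd _)
      ((hd _).const_mul _), fderiv_const_mul (hd _)]
    simp [mul_add]
  have h2 : ∀ a, fderiv ℝ (wirt u f) p a = (1 / 2 : ℂ) * (fderiv ℝ (fun q => fderiv ℝ f q u) p a
      - Complex.I * fderiv ℝ (fun q => fderiv ℝ f q (Complex.I • u)) p a) := by
    intro a
    change fderiv ℝ (fun q => (1 / 2 : ℂ) * (fderiv ℝ f q u
      - Complex.I * fderiv ℝ f q (Complex.I • u))) p a = _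
    rw [fderiv_const_mul ((hd _).fun_sub ((hd _).const_mul _)), fderiv_fun_sub (hd _)
      ((hd _).const_mul _), fderiv_const_mul (hd _)]
    simp
  rw [wirt, wirtBar, h1, h1, h2, h2]
  simp only [dirDeriv_comm hs hf hp w, dirDeriv_comm hs hf hp (Complex.I • w)]
  ring

end Wirtinger

lemma fderiv_comp_fst {F : Type*} [NormedAddCommGroup F] [NormedSpace ℝ F] {f : Cn n → F}
    {p : Cn n × Cn n} (hf : DifferentiableAt ℝ f p.1) (X : Cn n × Cn n) :
    fderiv ℝ (fun q : Cn n × Cn n => f q.1) p X = fderiv ℝ f p.1 X.1 := by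
  have : HasFDerivAt (fun q : Cn n × Cn n => f q.1)
      ((fderiv ℝ f p.1).comp (ContinuousLinearMap.fst ℝ (Cn n) (Cn n))) p :=
    hf.hasFDerivAt.comp p hasFDerivAt_fst
  rw [this.fderiv]
  rfl

lemma dz_comp_fst {f : Cn n → ℂ} {p : Cn n × Cn n} (hf : DifferentiableAt ℝ f p.1) (μ : Fin n) :
    dz μ (fun q => f q.1) p = wirt (cvec μ) f p.1 := by
  rw [dz, wirt, wirt, fderiv_comp_fst hf, fderiv_comp_fst hf]
  rfl

lemma dzBar_comp_fst {f : Cn n → ℂ} {p : Cn n × Cn n} (hf : DifferentiableAt ℝ f p.1)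
    (μ : Fin n) : dzBar μ (fun q => f q.1) p = wirtBar (cvec μ) f p.1 := by
  rw [dzBar, wirtBar, wirtBar, fderiv_comp_fst hf, fderiv_comp_fst hf]
  rfl

lemma dv_comp_fst {f : Cn n → ℂ} {p : Cn n × Cn n} (hf : DifferentiableAt ℝ f p.1)
    (μ : Fin n) : dv μ (fun q => f q.1) p = 0 := by
  rw [dv, wirt, fderiv_comp_fst hf, fderiv_comp_fst hf]
  simp

lemma dvBar_comp_fst {f : Cn n → ℂ} {p : Cn n × Cn n} (hf : DifferentiableAt ℝ f p.1)
    (μ : Fin n) : dvBar μ (fun q => f q.1) p = 0 := by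
  rw [dvBar, wirtBar, fderiv_comp_fst hf, fderiv_comp_fst hf]
  simp

/-! ### The Hermitian metric defined by `G` -/

/-- The polarization of `G` on the fibre over `z`. -/
noncomputable def polAt (G : Cn n × Cn n → ℝ) (u w : Cn n) (z : Cn n) : ℂ :=
  pol (fun v => G (z, v)) u w

/-- The matrix of the polarization of `G` on the fibre over `z`. -/
noncomputable def hermMat (G : Cn n × Cn n → ℝ) (z : Cn n) : Matrix (Fin n) (Fin n) ℂ :=
  Matrix.of fun α β => polAt G (cvec α) (cvec β) z

/-- The matrix of the real part of the polarization of `G` on the fibre over `z`. -/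
noncomputable def symMat (G : Cn n × Cn n → ℝ) (j k : RIdx n) (z : Cn n) : ℝ :=
  (polAt G (rvec j) (rvec k) z).re

namespace LocalFinsler

variable {G : Cn n × Cn n → ℝ} {U : Set (Cn n)}

lemma contDiffOn_fixed (h : LocalFinsler G U) (v : Cn n) :
    ContDiffOn ℝ ∞ (fun z => G (z, v)) U := by
  by_cases hv : v = 0
  · subst hv
    exact (contDiffOn_const (c := (0 : ℝ))).congr fun z hz => h.apply_zero hz
  · exact h.smooth.comp (contDiff_id.prodMk contDiff_const).contDiffOn fun z hz => ⟨hz, hv⟩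

lemma contDiffOn_polAt (h : LocalFinsler G U) (u w : Cn n) :
    ContDiffOn ℝ ∞ (polAt G u w) U := by
  have h1 : ∀ a b : Cn n, ContDiffOn ℝ ∞
      (fun z => (((1 / 4) * (G (z, a) - G (z, b)) : ℝ) : ℂ)) U := fun a b =>
    Complex.ofRealCLM.contDiff.comp_contDiffOn
      (contDiffOn_const.mul ((h.contDiffOn_fixed a).sub (h.contDiffOn_fixed b)))
  exact (h1 _ _).add ((h1 _ _).mul contDiffOn_const)

lemma contDiffOn_hermMat (h : LocalFinsler G U) (α β : Fin n) :
    ContDiffOn ℝ ∞ (fun z => hermMat G z α β) U :=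
  h.contDiffOn_polAt _ _

lemma differentiableAt_symMat (h : LocalFinsler G U) {z : Cn n} (hz : z ∈ U) (j k : RIdx n) :
    DifferentiableAt ℝ (symMat G j k) z :=
  differentiableAt_of_contDiffOn h.isOpen
    (Complex.reCLM.contDiff.comp_contDiffOn (h.contDiffOn_polAt _ _)) hz

lemma hermMat_conj (h : LocalFinsler G U) {z : Cn n} (hz : z ∈ U) (α β : Fin n) :
    conj (hermMat G z α β) = hermMat G z β α := by
  obtain ⟨b, hb, hQ, -⟩ := h.exists_invForm hz
  exact hb.pol_conj hQ _ _

lemma eq_sum_hermMat (h : LocalFinsler G U) {z : Cn n} (hz : z ∈ U) (v : Cn n) :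
    (G (z, v) : ℂ) = ∑ α, ∑ β, hermMat G z α β * v α * conj (v β) := by
  obtain ⟨b, hb, hQ, -⟩ := h.exists_invForm hz
  rw [← hb.pol_self hQ v, hb.pol_eq_sum hQ]
  rfl

lemma realMetric_eq (h : LocalFinsler G U) {p : Cn n × Cn n}
    (hp : p ∈ U ×ˢ {v : Cn n | v ≠ 0}) (j k : RIdx n) :
    realMetric G p j k = symMat G j k p.1 := by
  obtain ⟨b, hb, hQ, hD⟩ := h.exists_invForm hp.1
  have h1 : polAt G (rvec j) (rvec k) p.1 = _ := hb.pol_eq hQ _ _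
  rw [symMat, h1]
  change (1 / 2 : ℝ) * fderiv ℝ (fun q => fderiv ℝ G q (0, rvec k)) (p.1, p.2) (0, rvec j) = _
  rw [hD p.2 hp.2, hb.symm]
  simp

lemma symMat_symm (h : LocalFinsler G U) {z : Cn n} (hz : z ∈ U) (j k : RIdx n) :
    symMat G j k z = symMat G k j z := by
  obtain ⟨b, hb, hQ, -⟩ := h.exists_invForm hz
  rw [symMat, symMat, show polAt G (rvec j) (rvec k) z = conj (polAt G (rvec k) (rvec j) z) from
    (hb.pol_conj hQ _ _).symm, Complex.conj_re]

lemma symMat_inr_inr (h : LocalFinsler G U) {z : Cn n} (hz : z ∈ U) (α β : Fin n) :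
    symMat G (Sum.inr α) (Sum.inr β) z = symMat G (Sum.inl α) (Sum.inl β) z := by
  obtain ⟨b, hb, hQ, -⟩ := h.exists_invForm hz
  have h1 : ∀ u w, (polAt G u w z).re = b u w := fun u w => by simp [polAt, hb.pol_eq hQ]
  rw [symMat, symMat, h1, h1]
  exact hb.inv _ _

lemma symMat_inr_inl (h : LocalFinsler G U) {z : Cn n} (hz : z ∈ U) (α β : Fin n) :
    symMat G (Sum.inr α) (Sum.inl β) z = -symMat G (Sum.inl α) (Sum.inr β) z := by
  obtain ⟨b, hb, hQ, -⟩ := h.exists_invForm hz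
  have h1 : ∀ u w, (polAt G u w z).re = b u w := fun u w => by simp [polAt, hb.pol_eq hQ]
  rw [symMat, symMat, h1, h1]
  exact hb.I_left _ _

lemma hermMat_eq_symMat (h : LocalFinsler G U) {z : Cn n} (hz : z ∈ U) (α β : Fin n) :
    hermMat G z α β = (symMat G (Sum.inl α) (Sum.inl β) z : ℂ)
      + (symMat G (Sum.inl α) (Sum.inr β) z : ℂ) * Complex.I := by
  obtain ⟨b, hb, hQ, -⟩ := h.exists_invForm hz
  have h1 : ∀ u w, (polAt G u w z).re = b u w := fun u w => by simp [polAt, hb.pol_eq hQ]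
  rw [symMat, symMat, h1, h1]
  exact hb.pol_eq hQ _ _

/-- The mixed Wirtinger derivative combines four real second derivatives along `e` and `ie`. Each is
twice a value of `b`, and invariance under `i` merges them into `b(e_α, e_β) + i b(e_α, i e_β)`. -/
lemma cMetric_eq (h : LocalFinsler G U) {p : Cn n × Cn n}
    (hp : p ∈ U ×ˢ {v : Cn n | v ≠ 0}) : cMetric G p = hermMat G p.1 := by
  ext α β
  obtain ⟨b, hb, hQ, hD⟩ := h.exists_invForm hp.1
  have hH : hermMat G p.1 α β = _ := hb.pol_eq hQ _ _
  have hI : ∀ v : Cn n, Complex.I • ((0 : Cn n), v) = (0, Complex.I • v) := by simp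
  have hd := fun a => differentiableAt_of_contDiffOn h.isOpen_slit
    (contDiffOn_dirDeriv h.isOpen_slit h.smooth a) hp
  have hbar : ∀ q ∈ U ×ˢ {v : Cn n | v ≠ 0}, dvBar β (toC G) q
      = (((1 / 2) * fderiv ℝ G q (0, cvec β) : ℝ) : ℂ)
        + (((1 / 2) * fderiv ℝ G q (0, Complex.I • cvec β) : ℝ) : ℂ) * Complex.I := by
    intro q hq
    have e : ∀ u, fderiv ℝ (toC G) q u = (fderiv ℝ G q u : ℂ) := by
      intro u
      rw [show toC G = fun q => (G q : ℂ) from rfl]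
      have := fderiv_re_add_im (differentiableAt_of_contDiffOn h.isOpen_slit h.smooth hq)
        (differentiableAt_const (0 : ℝ)) u
      simpa using this
    rw [dvBar, wirtBar, e, e, hI]
    push_cast
    ring
  have hp' : p = (p.1, p.2) := rfl
  change dv α (dvBar β (toC G)) p = _
  rw [dv, wirt_congr_on h.isOpen_slit hbar hp, wirt,
    fderiv_re_add_im ((hd _).const_mul _) ((hd _).const_mul _),
    fderiv_re_add_im ((hd _).const_mul _) ((hd _).const_mul _), fderiv_const_mul (hd _),
    fderiv_const_mul (hd _), hI, hH]
  simp only [_root_.smul_apply, smul_eq_mul]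
  rw [hp', hD _ hp.2, hD _ hp.2, hD _ hp.2, hD _ hp.2, hb.inv, hb.I_left, hb.symm (cvec β),
    ← neg_eq_iff_eq_neg.2 (hb.I_left (cvec α) (cvec β)), hb.symm (cvec β)]
  push_cast
  linear_combination (-(b (cvec α) (cvec β) : ℂ) / 2) * Complex.I_sq

end LocalFinsler

/-! ### Horizontal part of `∇𝐉 = 0` and the Kähler condition -/

namespace LocalFinsler

variable {G : Cn n × Cn n → ℝ} {U : Set (Cn n)}

/-- The metric does not depend on the fibre variable, so the non-linear connection multiplies zero
and never has to be computed. -/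
lemma realDelta_realMetric (h : LocalFinsler G U) {p : Cn n × Cn n}
    (hp : p ∈ U ×ˢ {v : Cn n | v ≠ 0}) (l j k : RIdx n) :
    realDelta G l (fun q => realMetric G q j k) p = fderiv ℝ (symMat G j k) p.1 (rvec l) := by
  have h1 : ∀ X, fderiv ℝ (fun q => realMetric G q j k) p X = fderiv ℝ (symMat G j k) p.1 X.1 := by
    intro X
    rw [fderiv_congr_on h.isOpen_slit (fun q hq => h.realMetric_eq hq j k) hp,
      fderiv_comp_fst (h.differentiableAt_symMat hp.1 j k)]
  simp only [realDelta, dx, dy, h1]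
  simp

lemma cartanVert_eq_zero (h : LocalFinsler G U) {p : Cn n × Cn n}
    (hp : p ∈ U ×ˢ {v : Cn n | v ≠ 0}) (k j l : RIdx n) : cartanVert G k j l p = 0 := by
  have : ∀ s, dy j (dy l (dy s G)) p = 0 := fun s => h.third_vert hp _ _ _
  simp [cartanVert, this]

/-- The coefficients of the Cartan connection are those of the Levi-Civita connection. -/
lemma sum_symMat_mul_cartanHor (h : LocalFinsler G U) {p : Cn n × Cn n}
    (hp : p ∈ U ×ˢ {v : Cn n | v ≠ 0}) (s j l : RIdx n) :
    2 * ∑ k, symMat G s k p.1 * cartanHor G k j l p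
      = fderiv ℝ (symMat G s j) p.1 (rvec l) - fderiv ℝ (symMat G j l) p.1 (rvec s)
        + fderiv ℝ (symMat G l s) p.1 (rvec j) := by
  have hdet : IsUnit (realMetric G p).det := (h.posDef p hp).det_pos.ne'.isUnit
  let K : RIdx n → ℝ := fun s => fderiv ℝ (symMat G s j) p.1 (rvec l)
    - fderiv ℝ (symMat G j l) p.1 (rvec s) + fderiv ℝ (symMat G l s) p.1 (rvec j)
  have h1 : (fun k => cartanHor G k j l p)
      = (1 / 2 : ℝ) • ((realMetric G p)⁻¹).mulVec K := by
    funext k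
    simp only [cartanHor, h.realDelta_realMetric hp, Matrix.mulVec, dotProduct, Pi.smul_apply,
      smul_eq_mul, Finset.mul_sum, K]
    exact Finset.sum_congr rfl fun s _ => by ring
  have h2 : ∑ k, symMat G s k p.1 * cartanHor G k j l p
      = (realMetric G p).mulVec (fun k => cartanHor G k j l p) s := by
    simp only [Matrix.mulVec, dotProduct, h.realMetric_eq hp]
  rw [h2, h1, Matrix.mulVec_smul, Matrix.mulVec_mulVec, Matrix.mul_nonsing_inv _ hdet,
    Matrix.one_mulVec]
  simp [K]

/-- The horizontal part of `∇𝐉 = 0`. -/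
lemma cartanHor_inr (h : LocalFinsler G U) {p : Cn n × Cn n}
    (hp : p ∈ U ×ˢ {v : Cn n | v ≠ 0}) (k l : RIdx n) (γ : Fin n) :
    cartanHor G k (Sum.inr γ) l p = vertJ (fun k => cartanHor G k (Sum.inl γ) l p) k := by
  -- The direction need not be horizontal for the non-linear connection: its vertical component
  -- meets only vanishing vertical coefficients.
  have key : ∀ j, cartanDeriv G (rvec l, 0) (fun _ => Pi.single j 1) p
      = fun k => cartanHor G k j l p := by
    intro j
    funext k
    simp [cartanDeriv, cartanForm, h.cartanVert_eq_zero hp, rcoord_rvec, Pi.single_apply,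
      - Fintype.sum_sum_type]
  have h1 := h.parallel p hp (rvec l, 0) (Pi.single (Sum.inl γ) 1)
  have h2 : vertJ (Pi.single (Sum.inl γ) (1 : ℝ)) = Pi.single (Sum.inr γ) 1 := by
    funext k
    rcases k with k | k <;> simp [vertJ, Pi.single_apply]
  rw [h2, key, key] at h1
  exact congrFun h1 k

/-- Lower the index in `∇_α(𝐉e_γ) = 𝐉∇_α e_γ` and insert the Koszul formula. The derivatives along
`e_α` cancel by invariance of the metric, and the rest is the real and imaginary content of the
closedness of the Kähler form. -/
lemma kahler_wirtBar (h : LocalFinsler G U) {z : Cn n} (hz : z ∈ U) (α β γ : Fin n) :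
    wirtBar (cvec γ) (fun x => hermMat G x α β) z
      = wirtBar (cvec β) (fun x => hermMat G x α γ) z := by
  -- Any nonzero fibre vector would do; the conclusion concerns only `z`.
  have hv : cvec α ≠ 0 := fun hv => by simpa [cvec] using congrFun hv α
  have hp : (z, cvec α) ∈ U ×ˢ {v : Cn n | v ≠ 0} := ⟨hz, hv⟩
  have hs := h.sum_symMat_mul_cartanHor hp
  have hA1 := fun k => h.cartanHor_inr hp (Sum.inl k) (Sum.inl α) γ
  have hA2 := fun k => h.cartanHor_inr hp (Sum.inr k) (Sum.inl α) γ
  simp only [vertJ] at hA1 hA2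
  have hsymm : ∀ j k u, fderiv ℝ (symMat G j k) z u = fderiv ℝ (symMat G k j) z u := fun j k u => by
    rw [fderiv_congr_on h.isOpen (fun x hx => h.symMat_symm hx j k) hz]
  have hrr : ∀ (j k : Fin n) u, fderiv ℝ (symMat G (Sum.inr j) (Sum.inr k)) z u
      = fderiv ℝ (symMat G (Sum.inl j) (Sum.inl k)) z u := fun j k u => by
    rw [fderiv_congr_on h.isOpen (fun x hx => h.symMat_inr_inr hx j k) hz]
  have hrl : ∀ (j k : Fin n) u, fderiv ℝ (symMat G (Sum.inr j) (Sum.inl k)) z u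
      = -fderiv ℝ (symMat G (Sum.inl j) (Sum.inr k)) z u := fun j k u => by
    rw [fderiv_congr_on h.isOpen (fun x hx => h.symMat_inr_inl hx j k) hz, fderiv_fun_neg]
    rfl
  -- Twice the identity `⟨e_β, ∇_α(𝐉e_γ)⟩ = -⟨𝐉e_β, ∇_α e_γ⟩`; `K2` below is `⟨𝐉e_β, ∇_α(𝐉e_γ)⟩ =
  -- ⟨e_β, ∇_α e_γ⟩`.
  have K1 : fderiv ℝ (symMat G (Sum.inl β) (Sum.inr γ)) z (rvec (Sum.inl α))
        - fderiv ℝ (symMat G (Sum.inr γ) (Sum.inl α)) z (rvec (Sum.inl β))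
        + fderiv ℝ (symMat G (Sum.inl α) (Sum.inl β)) z (rvec (Sum.inr γ))
      = -(fderiv ℝ (symMat G (Sum.inr β) (Sum.inl γ)) z (rvec (Sum.inl α))
        - fderiv ℝ (symMat G (Sum.inl γ) (Sum.inl α)) z (rvec (Sum.inr β))
        + fderiv ℝ (symMat G (Sum.inl α) (Sum.inr β)) z (rvec (Sum.inl γ))) := by
    rw [← hs, ← hs, ← mul_neg, ← Finset.sum_neg_distrib]
    simp only [Fintype.sum_sum_type, hA1, hA2, h.symMat_inr_inr hz, h.symMat_inr_inl hz]
    rw [add_comm]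
    congr 2 <;> exact Finset.sum_congr rfl fun _ _ => by ring
  have K2 : fderiv ℝ (symMat G (Sum.inr β) (Sum.inr γ)) z (rvec (Sum.inl α))
        - fderiv ℝ (symMat G (Sum.inr γ) (Sum.inl α)) z (rvec (Sum.inr β))
        + fderiv ℝ (symMat G (Sum.inl α) (Sum.inr β)) z (rvec (Sum.inr γ))
      = fderiv ℝ (symMat G (Sum.inl β) (Sum.inl γ)) z (rvec (Sum.inl α))
        - fderiv ℝ (symMat G (Sum.inl γ) (Sum.inl α)) z (rvec (Sum.inl β))
        + fderiv ℝ (symMat G (Sum.inl α) (Sum.inl β)) z (rvec (Sum.inl γ)) := by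
    rw [← hs, ← hs]
    simp only [Fintype.sum_sum_type, hA1, hA2, h.symMat_inr_inr hz, h.symMat_inr_inl hz]
    rw [add_comm]
    congr 2
    exact Finset.sum_congr rfl fun _ _ => by ring
  rw [hrl, hrl, hsymm (Sum.inl γ) (Sum.inr α), hrl, hsymm (Sum.inl γ) (Sum.inl α)] at K1
  rw [hrr, hrl, hsymm (Sum.inl γ) (Sum.inr α), hrl, hsymm (Sum.inl γ) (Sum.inl α)] at K2
  have hd := h.differentiableAt_symMat hz
  rw [wirtBar_congr_on h.isOpen (fun x hx => h.hermMat_eq_symMat hx α β) hz,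
    wirtBar_congr_on h.isOpen (fun x hx => h.hermMat_eq_symMat hx α γ) hz, wirtBar, wirtBar,
    fderiv_re_add_im (hd _ _) (hd _ _), fderiv_re_add_im (hd _ _) (hd _ _),
    fderiv_re_add_im (hd _ _) (hd _ _), fderiv_re_add_im (hd _ _) (hd _ _)]
  simp only [rvec] at K1 K2
  have K1' := congrArg (fun x : ℝ => (x : ℂ)) K1
  have K2' := congrArg (fun x : ℝ => (x : ℂ)) K2
  push_cast at K1' K2'
  linear_combination (Complex.I / 2) * K1' - K2' / 2
    + (1 / 2) * (fderiv ℝ (symMat G (Sum.inl α) (Sum.inr β)) z (Complex.I • cvec γ)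
      - fderiv ℝ (symMat G (Sum.inl α) (Sum.inr γ)) z (Complex.I • cvec β) : ℂ) * Complex.I_sq

end LocalFinsler

/-! ### Determinants of matrix valued functions -/

section Determinant

variable {E ι : Type*} [NormedAddCommGroup E] [NormedSpace ℝ E] [Fintype ι] [DecidableEq ι]
  {A : E → Matrix ι ι ℂ} {s : Set E} {p : E}

lemma contDiffOn_det (hA : ∀ i j, ContDiffOn ℝ ∞ (fun q => A q i j) s) :
    ContDiffOn ℝ ∞ (fun q => (A q).det) s := by
  simp only [Matrix.det_apply']
  exact ContDiffOn.sum fun σ _ => contDiffOn_const.mul (contDiffOn_prod fun i _ => hA _ _)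

/-- By Cramer's rule an entry of the inverse is a quotient of determinants, which are polynomials in
the entries. -/
lemma contDiffOn_inv_apply (hA : ∀ i j, ContDiffOn ℝ ∞ (fun q => A q i j) s)
    (hdet : ∀ q ∈ s, (A q).det ≠ 0) (i j : ι) :
    ContDiffOn ℝ ∞ (fun q => (A q)⁻¹ i j) s := by
  have h1 : ∀ q, (A q)⁻¹ i j = (A q).det⁻¹ * ((A q).updateRow j (Pi.single i 1)).det := by
    intro q
    rw [Matrix.inv_def, Ring.inverse_eq_inv', Matrix.smul_apply, Matrix.adjugate_apply, smul_eq_mul]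
  simp only [h1]
  refine ((contDiffOn_det hA).inv hdet).mul (contDiffOn_det fun k l => ?_)
  by_cases hk : k = j
  · subst hk
    simp only [Matrix.updateRow_self]
    exact contDiffOn_const
  · simp only [Matrix.updateRow_ne hk]
    exact hA k l

/-- Jacobi's formula. -/
lemma fderiv_det (hA : ∀ i j, DifferentiableAt ℝ (fun q => A q i j) p) (u : E) :
    fderiv ℝ (fun q => (A q).det) p u
      = ∑ i, ∑ k, (A p).adjugate i k * fderiv ℝ (fun q => A q k i) p u := by
  -- Differentiating the Leibniz expansion gives, for each column, the determinant with that column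
  -- differentiated; Cramer's rule turns it into a row of the adjugate.
  have h1 : ∀ σ : Equiv.Perm ι, HasFDerivAt (fun q => ∏ i, A q (σ i) i)
      (∑ i, (∏ j ∈ Finset.univ.erase i, A p (σ j) j) • fderiv ℝ (fun q => A q (σ i) i) p) p :=
    fun σ => HasFDerivAt.finsetProd fun i _ => (hA (σ i) i).hasFDerivAt
  have h2 : HasFDerivAt (fun q => (A q).det) (∑ σ : Equiv.Perm ι, ((Equiv.Perm.sign σ : ℤ) : ℂ) •
      (∑ i, (∏ j ∈ Finset.univ.erase i, A p (σ j) j) • fderiv ℝ (fun q => A q (σ i) i) p)) p := by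
    simp only [Matrix.det_apply']
    exact HasFDerivAt.fun_sum fun σ _ => (h1 σ).const_mul _
  have h3 : ∀ i, ∑ k, (A p).adjugate i k * fderiv ℝ (fun q => A q k i) p u
      = ((A p).updateCol i (fun k => fderiv ℝ (fun q => A q k i) p u)).det := by
    intro i
    rw [← Matrix.cramer_apply, Matrix.cramer_eq_adjugate_mulVec]
    rfl
  rw [h2.fderiv]
  simp only [h3, Matrix.det_apply']
  rw [Finset.sum_comm]
  simp only [_root_.sum_apply, _root_.smul_apply, smul_eq_mul, Finset.mul_sum]
  refine Finset.sum_congr rfl fun σ _ => Finset.sum_congr rfl fun i _ => ?_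
  rw [← Finset.prod_erase_mul _ _ (Finset.mem_univ i), Matrix.updateCol_self]
  congr 2
  exact Finset.prod_congr rfl fun j hj => (Matrix.updateCol_ne (Finset.ne_of_mem_erase hj)).symm

end Determinant

/-! ### Polarization of biquadratic forms -/

/-- A form that is symmetric bilinear in its first two and symmetric conjugate bilinear in its last
two arguments vanishes if it vanishes on the diagonal. -/
lemma biquadratic_eq_zero {V : Type*} [AddCommGroup V] [Module ℂ V] {T : V → V → V → V → ℂ}
    (add₁ : ∀ a a' b c d, T (a + a') b c d = T a b c d + T a' b c d)
    (smul₁ : ∀ (t : ℂ) a b c d, T (t • a) b c d = t * T a b c d)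
    (symm₁ : ∀ a b c d, T a b c d = T b a c d)
    (add₃ : ∀ a b c c' d, T a b (c + c') d = T a b c d + T a b c' d)
    (smul₃ : ∀ (t : ℂ) a b c d, T a b (t • c) d = conj t * T a b c d)
    (symm₃ : ∀ a b c d, T a b c d = T a b d c)
    (zero : ∀ v, T v v v v = 0) (a b c d : V) : T a b c d = 0 := by
  have add₂ : ∀ a b b' c d, T a (b + b') c d = T a b c d + T a b' c d := fun a b b' c d => by
    rw [symm₁, add₁, symm₁ b, symm₁ b']
  have smul₂ : ∀ (t : ℂ) a b c d, T a (t • b) c d = t * T a b c d := fun t a b c d => by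
    rw [symm₁, smul₁, symm₁ b]
  have add₄ : ∀ a b c d d', T a b c (d + d') = T a b c d + T a b c d' := fun a b c d d' => by
    rw [symm₃, add₃, symm₃ _ _ d, symm₃ _ _ d']
  have smul₄ : ∀ (t : ℂ) a b c d, T a b c (t • d) = conj t * T a b c d := fun t a b c d => by
    rw [symm₃, smul₃, symm₃ _ _ d]
  have h1 : ∀ a b, T a a b b = 0 := by
    intro a b
    -- Expansion on the diagonal at `a + tb`. Averaging over `±t` removes the odd terms, and `t = 1,
    -- i, 1 + i` separate the three even ones.
    have key : ∀ t : ℂ, conj t ^ 2 * T a a b b + 4 * t * conj t * T a b a b + t ^ 2 * T b b a a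
        + 2 * conj t * T a a a b + 2 * t * T a b a a + 2 * t * conj t ^ 2 * T a b b b
        + 2 * t ^ 2 * conj t * T b b a b = 0 := by
      intro t
      have := zero (a + t • b)
      simp only [add₁, add₂, add₃, add₄, smul₁, smul₂, smul₃, smul₄, symm₁ b a, symm₃ _ _ b a,
        zero] at this
      linear_combination this
    have e1 := key 1
    have e2 := key (-1)
    have e3 := key Complex.I
    have e4 := key (-Complex.I)
    have e5 := key (1 + Complex.I)
    have e6 := key (-(1 + Complex.I))
    simp only [map_neg, map_add, map_one, Complex.conj_I] at e1 e2 e3 e4 e5 e6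
    have I2 := Complex.I_sq
    have f1 : T a a b b + 4 * T a b a b + T b b a a = 0 := by linear_combination (e1 + e2) / 2
    have f2 : -T a a b b + 4 * T a b a b - T b b a a = 0 := by
      linear_combination (e3 + e4) / 2 - (T a a b b - 4 * T a b a b + T b b a a) * I2
    have f3 : -2 * Complex.I * T a a b b + 8 * T a b a b + 2 * Complex.I * T b b a a = 0 := by
      linear_combination (e5 + e6) / 2 - (T a a b b - 4 * T a b a b + T b b a a) * I2
    have f4 : 4 * Complex.I * T a a b b = 0 := by
      linear_combination Complex.I * (f1 - f2) - f3 + (f1 + f2)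
    simpa [Complex.I_ne_zero] using f4
  have h2 : ∀ a b c, T a b c c = 0 := by
    intro a b c
    have := h1 (a + b) c
    rw [add₁, add₂, add₂, h1, h1, symm₁ b a] at this
    linear_combination this / 2
  have := h2 a b (c + d)
  rw [add₃, add₄, add₄, h2, h2, symm₃ _ _ d c] at this
  linear_combination this / 2

/-- Used to pass from the curvature on vectors `v` to the full curvature tensor. -/
lemma coeff_eq_zero_of_biquadratic {n : ℕ} {S : Fin n → Fin n → Fin n → Fin n → ℂ}
    (h₁ : ∀ β μ γ ν, S β μ γ ν = S μ β γ ν) (h₃ : ∀ β μ γ ν, S β μ γ ν = S β μ ν γ)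
    (h : ∀ v : Cn n, v ≠ 0 →
      ∑ β, ∑ μ, ∑ γ, ∑ ν, S β μ γ ν * v β * v μ * conj (v γ) * conj (v ν) = 0)
    (β μ γ ν : Fin n) : S β μ γ ν = 0 := by
  have key := biquadratic_eq_zero (V := Cn n) (T := fun a b c d =>
    ∑ β, ∑ μ, ∑ γ, ∑ ν, S β μ γ ν * a β * b μ * conj (c γ) * conj (d ν))
    (fun a a' b c d => by simp only [Pi.add_apply, mul_add, add_mul, Finset.sum_add_distrib])
    (fun t a b c d => by
      simp only [Pi.smul_apply, smul_eq_mul, Finset.mul_sum]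
      exact Finset.sum_congr rfl fun _ _ => Finset.sum_congr rfl fun _ _ =>
        Finset.sum_congr rfl fun _ _ => Finset.sum_congr rfl fun _ _ => by ring)
    (fun a b c d => by
      rw [Finset.sum_comm]
      exact Finset.sum_congr rfl fun β _ => Finset.sum_congr rfl fun μ _ =>
        Finset.sum_congr rfl fun _ _ => Finset.sum_congr rfl fun _ _ => by rw [h₁ μ β]; ring)
    (fun a b c c' d => by
      simp only [Pi.add_apply, map_add, mul_add, add_mul, Finset.sum_add_distrib])
    (fun t a b c d => by
      simp only [Pi.smul_apply, smul_eq_mul, map_mul, Finset.mul_sum]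
      exact Finset.sum_congr rfl fun _ _ => Finset.sum_congr rfl fun _ _ =>
        Finset.sum_congr rfl fun _ _ => Finset.sum_congr rfl fun _ _ => by ring)
    (fun a b c d => Finset.sum_congr rfl fun β _ => Finset.sum_congr rfl fun μ _ => by
      rw [Finset.sum_comm]
      exact Finset.sum_congr rfl fun γ _ => Finset.sum_congr rfl fun ν _ => by rw [h₃ β μ ν γ]; ring)
    (fun v => by
      by_cases hv : v = 0
      · simp [hv]
      · exact h v hv)
    (cvec β) (cvec μ) (cvec γ) (cvec ν)
  have e : ∀ i j : Fin n, conj (cvec i j) = if j = i then 1 else 0 := fun i j => by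
    simp [cvec, Pi.single_apply, apply_ite]
  simp only [e] at key
  simpa only [cvec, Pi.single_apply, mul_ite, mul_one, mul_zero, ite_mul, zero_mul,
    Finset.sum_ite_eq', Finset.mem_univ, if_true] using key

/-- The Christoffel symbols `h^{τ̄α} ∂_μ h_{βτ̄}` of the Hermitian metric defined by `G`. -/
noncomputable def christoffel (G : Cn n × Cn n → ℝ) (α β μ : Fin n) (z : Cn n) : ℂ :=
  ∑ τ, (hermMat G z)⁻¹ τ α * wirt (cvec μ) (fun x => hermMat G x β τ) z

/-! ### Nondegeneracy and Christoffel symbols of the Hermitian metric -/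

namespace LocalFinsler

variable {G : Cn n × Cn n → ℝ} {U : Set (Cn n)}

/-- The conjugate of a kernel vector would be a nonzero vector on which `G` vanishes. -/
lemma det_ne_zero (h : LocalFinsler G U) {z : Cn n} (hz : z ∈ U) : (hermMat G z).det ≠ 0 := by
  intro hdet
  obtain ⟨w, hw, hw0⟩ := Matrix.exists_mulVec_eq_zero_iff.2 hdet
  have hv : (fun α => conj (w α)) ≠ 0 := fun h0 => hw <| by
    funext α
    simpa using congrFun h0 α
  have h1 := h.eq_sum_hermMat hz (fun α => conj (w α))
  have h2 : ∀ α, ∑ β, hermMat G z α β * conj (w α) * conj (conj (w β)) = 0 := by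
    intro α
    have := congrFun hw0 α
    rw [Matrix.mulVec, dotProduct] at this
    calc _ = conj (w α) * ∑ β, hermMat G z α β * w β := by
          rw [Finset.mul_sum]
          exact Finset.sum_congr rfl fun β _ => by rw [Complex.conj_conj]; ring
      _ = 0 := by rw [this]; simp
  rw [Finset.sum_eq_zero fun α _ => h2 α] at h1
  exact (h.pos z hz _ hv).ne' (by exact_mod_cast h1)

lemma ofReal_re_det (h : LocalFinsler G U) {z : Cn n} (hz : z ∈ U) :
    (((hermMat G z).det.re : ℝ) : ℂ) = (hermMat G z).det := by
  have h1 : (hermMat G z).conjTranspose = hermMat G z := by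
    ext α β
    rw [Matrix.conjTranspose_apply]
    exact h.hermMat_conj hz β α
  rw [← Complex.conj_eq_iff_re]
  conv_rhs => rw [← h1, Matrix.det_conjTranspose]
  rfl

lemma sum_inv_mul (h : LocalFinsler G U) {z : Cn n} (hz : z ∈ U) (τ γ : Fin n) :
    ∑ α, (hermMat G z)⁻¹ τ α * hermMat G z α γ = if τ = γ then 1 else 0 := by
  have := congrFun (congrFun (Matrix.nonsing_inv_mul _ (h.det_ne_zero hz).isUnit) τ) γ
  simpa [Matrix.mul_apply, Matrix.one_apply] using this

lemma sum_mul_inv (h : LocalFinsler G U) {z : Cn n} (hz : z ∈ U) (τ γ : Fin n) :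
    ∑ α, hermMat G z τ α * (hermMat G z)⁻¹ α γ = if τ = γ then 1 else 0 := by
  have := congrFun (congrFun (Matrix.mul_nonsing_inv _ (h.det_ne_zero hz).isUnit) τ) γ
  simpa [Matrix.mul_apply, Matrix.one_apply] using this

lemma contDiffOn_christoffel (h : LocalFinsler G U) (α β μ : Fin n) :
    ContDiffOn ℝ ∞ (christoffel G α β μ) U :=
  ContDiffOn.sum fun τ _ => (contDiffOn_inv_apply h.contDiffOn_hermMat
    (fun _ hz => h.det_ne_zero hz) τ α).mul (contDiffOn_wirt h.isOpen (h.contDiffOn_hermMat β τ) _)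

lemma kahler_wirt (h : LocalFinsler G U) {z : Cn n} (hz : z ∈ U) (α β γ : Fin n) :
    wirt (cvec γ) (fun x => hermMat G x α β) z = wirt (cvec α) (fun x => hermMat G x γ β) z := by
  have h1 : ∀ α β γ : Fin n, wirt (cvec γ) (fun x => hermMat G x α β) z
      = conj (wirtBar (cvec γ) (fun x => hermMat G x β α) z) := by
    intro α β γ
    rw [conj_wirtBar]
    exact wirt_congr_on h.isOpen (fun x hx => (h.hermMat_conj hx β α).symm) hz _
  rw [h1, h1, h.kahler_wirtBar hz]

lemma christoffel_symm (h : LocalFinsler G U) {z : Cn n} (hz : z ∈ U) (α β μ : Fin n) :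
    christoffel G α β μ z = christoffel G α μ β z :=
  Finset.sum_congr rfl fun τ _ => by rw [h.kahler_wirt hz]

lemma sum_christoffel_mul (h : LocalFinsler G U) {z : Cn n} (hz : z ∈ U) (β γ μ : Fin n) :
    ∑ α, christoffel G α β μ z * hermMat G z α γ
      = wirt (cvec μ) (fun x => hermMat G x β γ) z := by
  simp only [christoffel, Finset.sum_mul]
  rw [Finset.sum_comm]
  calc _ = ∑ τ, wirt (cvec μ) (fun x => hermMat G x β τ) z
          * ∑ α, (hermMat G z)⁻¹ τ α * hermMat G z α γ :=
        Finset.sum_congr rfl fun τ _ => by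
          rw [Finset.mul_sum]
          exact Finset.sum_congr rfl fun α _ => by ring
    _ = _ := by simp [h.sum_inv_mul hz]

/-! ### The Chern-Finsler connection -/
lemma cMetric_apply_on (h : LocalFinsler G U) (α β : Fin n) :
    ∀ q ∈ U ×ˢ {v : Cn n | v ≠ 0}, cMetric G q α β = hermMat G q.1 α β :=
  fun q hq => by rw [h.cMetric_eq hq]

lemma differentiableAt_hermMat (h : LocalFinsler G U) {z : Cn n} (hz : z ∈ U) (α β : Fin n) :
    DifferentiableAt ℝ (fun x => hermMat G x α β) z :=
  differentiableAt_of_contDiffOn h.isOpen (h.contDiffOn_hermMat α β) hz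

lemma differentiableAt_christoffel (h : LocalFinsler G U) {z : Cn n} (hz : z ∈ U)
    (α β μ : Fin n) : DifferentiableAt ℝ (christoffel G α β μ) z :=
  differentiableAt_of_contDiffOn h.isOpen (h.contDiffOn_christoffel α β μ) hz

lemma dv_cMetric (h : LocalFinsler G U) {p : Cn n × Cn n}
    (hp : p ∈ U ×ˢ {v : Cn n | v ≠ 0}) (α β γ : Fin n) :
    dv γ (fun q => cMetric G q α β) p = 0 := by
  rw [dv, wirt_congr_on h.isOpen_slit (h.cMetric_apply_on α β) hp]
  exact dv_comp_fst (h.differentiableAt_hermMat hp.1 α β) γ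

lemma chernVert_eq (h : LocalFinsler G U) {p : Cn n × Cn n}
    (hp : p ∈ U ×ˢ {v : Cn n | v ≠ 0}) (α β γ : Fin n) : chernVert G α β γ p = 0 := by
  simp [chernVert, h.dv_cMetric hp]

lemma chernHor_eq (h : LocalFinsler G U) {p : Cn n × Cn n}
    (hp : p ∈ U ×ˢ {v : Cn n | v ≠ 0}) (α β μ : Fin n) :
    chernHor G α β μ p = christoffel G α β μ p.1 := by
  refine Finset.sum_congr rfl fun τ _ => ?_
  rw [h.cMetric_eq hp, chernDelta]
  simp only [h.dv_cMetric hp, mul_zero, Finset.sum_const_zero, sub_zero]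
  rw [dz, wirt_congr_on h.isOpen_slit (h.cMetric_apply_on β τ) hp]
  exact congrArg _ (dz_comp_fst (h.differentiableAt_hermMat hp.1 β τ) μ)

lemma dzBar_chernHor (h : LocalFinsler G U) {p : Cn n × Cn n}
    (hp : p ∈ U ×ˢ {v : Cn n | v ≠ 0}) (α β μ ν : Fin n) :
    dzBar ν (chernHor G α β μ) p = wirtBar (cvec ν) (christoffel G α β μ) p.1 := by
  rw [dzBar, wirtBar_congr_on h.isOpen_slit (fun q hq => h.chernHor_eq hq α β μ) hp]
  exact dzBar_comp_fst (h.differentiableAt_christoffel hp.1 α β μ) ν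

lemma chernCurv_eq (h : LocalFinsler G U) {p : Cn n × Cn n}
    (hp : p ∈ U ×ˢ {v : Cn n | v ≠ 0}) (α β μ ν : Fin n) :
    chernCurv G α β μ ν p = -wirtBar (cvec ν) (christoffel G α β μ) p.1 := by
  have h1 : ∀ γ, dvBar γ (chernHor G α β μ) p = 0 := by
    intro γ
    rw [dvBar, wirtBar_congr_on h.isOpen_slit (fun q hq => h.chernHor_eq hq α β μ) hp]
    exact dvBar_comp_fst (h.differentiableAt_christoffel hp.1 α β μ) γ
  simp [chernCurv, h.chernVert_eq hp, chernDeltaBar, h1, h.dzBar_chernHor hp]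

/-! ### The curvature tensor -/

/-- The lowered curvature tensor is the usual one of a Kähler metric. -/
lemma sum_curv_mul (h : LocalFinsler G U) {z : Cn n} (hz : z ∈ U) (β γ μ ν : Fin n) :
    ∑ α, hermMat G z α γ * -wirtBar (cvec ν) (christoffel G α β μ) z
      = ∑ α, christoffel G α β μ z * wirtBar (cvec ν) (fun x => hermMat G x α γ) z
        - wirtBar (cvec ν) (wirt (cvec μ) (fun x => hermMat G x β γ)) z := by
  rw [← wirtBar_congr_on h.isOpen (fun x hx => h.sum_christoffel_mul hx β γ μ) hz,
    wirtBar_sum _ (fun α _ => (h.differentiableAt_christoffel hz α β μ).fun_mul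
      (h.differentiableAt_hermMat hz α γ)), ← Finset.sum_sub_distrib]
  refine Finset.sum_congr rfl fun α _ => ?_
  rw [wirtBar_mul (h.differentiableAt_christoffel hz α β μ) (h.differentiableAt_hermMat hz α γ)]
  ring

/-- Constant holomorphic sectional curvature determines the Ricci tensor. -/
lemma ricci_of_constHolSecCurv (h : LocalFinsler G U) {c : ℝ}
    (hc : ∀ p ∈ U ×ˢ {v : Cn n | v ≠ 0}, holSecCurv G p = c) {z : Cn n} (hz : z ∈ U)
    (μ ν : Fin n) :
    ∑ α, -wirtBar (cvec ν) (christoffel G α α μ) z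
      = ((c * ((n : ℝ) + 1) / 4 : ℝ) : ℂ) * hermMat G z μ ν := by
  -- The lowered curvature, with the holomorphic indices `β, μ` before the antiholomorphic `γ, ν`,
  -- so that both symmetries are adjacent swaps.
  let R : Fin n → Fin n → Fin n → Fin n → ℂ := fun β μ γ ν =>
    ∑ α, hermMat G z α γ * -wirtBar (cvec ν) (christoffel G α β μ) z
  have hR1 : ∀ β μ γ ν, R β μ γ ν = R μ β γ ν := by
    intro β μ γ ν
    refine Finset.sum_congr rfl fun α _ => ?_
    rw [wirtBar_congr_on h.isOpen (fun x hx => h.christoffel_symm hx α β μ) hz]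
  have hR3 : ∀ β μ γ ν, R β μ γ ν = R β μ ν γ := by
    intro β μ γ ν
    simp only [R, h.sum_curv_mul hz]
    congr 1
    · exact Finset.sum_congr rfl fun α _ => by rw [h.kahler_wirtBar hz]
    · rw [← wirt_wirtBar_comm h.isOpen (h.contDiffOn_hermMat _ _) hz,
        ← wirt_wirtBar_comm h.isOpen (h.contDiffOn_hermMat _ _) hz,
        wirt_congr_on h.isOpen (fun x hx => h.kahler_wirtBar hx β γ ν) hz]
  have hRv : ∀ v : Cn n, v ≠ 0 →
      ∑ β, ∑ μ, ∑ γ, ∑ ν, R β μ γ ν * v β * v μ * conj (v γ) * conj (v ν)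
        = (c : ℂ) / 2 * (G (z, v) : ℂ) ^ 2 := by
    intro v hv
    have hp : (z, v) ∈ U ×ˢ {v : Cn n | v ≠ 0} := ⟨hz, hv⟩
    have hG : (G (z, v) : ℂ) ≠ 0 := by exact_mod_cast (h.pos z hz v hv).ne'
    have h1 := hc _ hp
    simp only [holSecCurv, h.cMetric_eq hp, h.chernCurv_eq hp, toC] at h1
    have h2 : ∑ α, ∑ β, ∑ μ, ∑ ν, ∑ γ, hermMat G z α γ *
        -wirtBar (cvec ν) (christoffel G α β μ) z * v β * v μ * conj (v ν) * conj (v γ)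
        = ∑ β, ∑ μ, ∑ γ, ∑ ν, R β μ γ ν * v β * v μ * conj (v γ) * conj (v ν) := by
      simp only [R, Finset.sum_mul]
      rw [Finset.sum_comm]
      refine Finset.sum_congr rfl fun β _ => ?_
      rw [Finset.sum_comm]
      refine Finset.sum_congr rfl fun μ _ => ?_
      rw [Finset.sum_comm, Finset.sum_comm (f := fun γ ν => ∑ α, hermMat G z α γ *
        -wirtBar (cvec ν) (christoffel G α β μ) z * v β * v μ * conj (v γ) * conj (v ν))]
      refine Finset.sum_congr rfl fun ν _ => ?_
      rw [Finset.sum_comm]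
      exact Finset.sum_congr rfl fun γ _ => Finset.sum_congr rfl fun α _ => by ring
    rw [h2] at h1
    rw [← h1]
    field_simp
  -- Difference from the model tensor. On the diagonal each product of `h` with itself gives `G²`,
  -- so the factor `c/4` matches the value `c/2 · G²` of `R`.
  let S : Fin n → Fin n → Fin n → Fin n → ℂ := fun β μ γ ν => R β μ γ ν
    - (c : ℂ) / 4 * (hermMat G z β γ * hermMat G z μ ν + hermMat G z β ν * hermMat G z μ γ)
  have hS : ∀ β μ γ ν, S β μ γ ν = 0 := by
    refine coeff_eq_zero_of_biquadratic (fun β μ γ ν => ?_) (fun β μ γ ν => ?_) fun v hv => ?_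
    · simp only [S]
      rw [hR1]
      ring
    · simp only [S]
      rw [hR3]
      ring
    · have h1 : ∑ β, ∑ μ, ∑ γ, ∑ ν, hermMat G z β γ * hermMat G z μ ν * v β * v μ * conj (v γ)
          * conj (v ν) = (G (z, v) : ℂ) ^ 2 := by
        rw [h.eq_sum_hermMat hz, sq, Finset.sum_mul_sum]
        refine Finset.sum_congr rfl fun β _ => Finset.sum_congr rfl fun μ _ => ?_
        rw [Finset.sum_mul_sum]
        exact Finset.sum_congr rfl fun γ _ => Finset.sum_congr rfl fun ν _ => by ring
      have h2 : ∑ β, ∑ μ, ∑ γ, ∑ ν, hermMat G z β ν * hermMat G z μ γ * v β * v μ * conj (v γ)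
          * conj (v ν) = (G (z, v) : ℂ) ^ 2 := by
        rw [← h1]
        refine Finset.sum_congr rfl fun β _ => Finset.sum_congr rfl fun μ _ => ?_
        rw [Finset.sum_comm]
        exact Finset.sum_congr rfl fun γ _ => Finset.sum_congr rfl fun ν _ => by ring
      calc _ = ∑ β, ∑ μ, ∑ γ, ∑ ν, R β μ γ ν * v β * v μ * conj (v γ) * conj (v ν)
            - (c : ℂ) / 4 * (∑ β, ∑ μ, ∑ γ, ∑ ν, hermMat G z β γ * hermMat G z μ ν * v β * v μ
              * conj (v γ) * conj (v ν) + ∑ β, ∑ μ, ∑ γ, ∑ ν, hermMat G z β ν * hermMat G z μ γ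
              * v β * v μ * conj (v γ) * conj (v ν)) := by
            simp only [← Finset.sum_add_distrib, Finset.mul_sum, ← Finset.sum_sub_distrib, S]
            exact Finset.sum_congr rfl fun _ _ => Finset.sum_congr rfl fun _ _ =>
              Finset.sum_congr rfl fun _ _ => Finset.sum_congr rfl fun _ _ => by ring
        _ = 0 := by
            rw [hRv v hv, h1, h2]
            ring
  -- Raising an index of the model tensor. Summed over `α`, the first product contributes `n h` and
  -- the second `h`, whence the factor `n + 1`.
  have hX : ∀ α, -wirtBar (cvec ν) (christoffel G α α μ) z
      = (c : ℂ) / 4 * ((∑ γ, hermMat G z α γ * (hermMat G z)⁻¹ γ α) * hermMat G z μ ν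
        + ∑ γ, hermMat G z μ γ * ((hermMat G z)⁻¹ γ α * hermMat G z α ν)) := by
    intro α
    have h1 : ∑ γ, R α μ γ ν * (hermMat G z)⁻¹ γ α
        = -wirtBar (cvec ν) (christoffel G α α μ) z := by
      simp only [R, Finset.sum_mul]
      rw [Finset.sum_comm]
      calc _ = ∑ α', -wirtBar (cvec ν) (christoffel G α' α μ) z
              * ∑ γ, hermMat G z α' γ * (hermMat G z)⁻¹ γ α :=
            Finset.sum_congr rfl fun α' _ => by
              rw [Finset.mul_sum]
              exact Finset.sum_congr rfl fun γ _ => by ring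
        _ = _ := by simp [h.sum_mul_inv hz]
    rw [← h1, Finset.sum_mul, ← Finset.sum_add_distrib, Finset.mul_sum]
    refine Finset.sum_congr rfl fun γ _ => ?_
    rw [sub_eq_zero.1 (hS α μ γ ν)]
    ring
  simp only [hX, ← Finset.mul_sum, Finset.sum_add_distrib, h.sum_mul_inv hz]
  rw [Finset.sum_comm]
  simp only [← Finset.mul_sum, h.sum_inv_mul hz]
  simp
  ring

/-- The logarithmic derivative of the determinant. -/
lemma wirt_log_det (h : LocalFinsler G U) {z : Cn n} (hz : z ∈ U) (μ : Fin n) :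
    wirt (cvec μ) (fun x => ((Real.log (hermMat G x).det.re : ℝ) : ℂ)) z
      = ∑ α, christoffel G α α μ z := by
  have hdet := contDiffOn_det h.contDiffOn_hermMat
  have hre : DifferentiableAt ℝ (fun x => (hermMat G x).det.re) z :=
    differentiableAt_of_contDiffOn h.isOpen (Complex.reCLM.contDiff.comp_contDiffOn hdet) hz
  have hne : (hermMat G z).det.re ≠ 0 := fun h0 => h.det_ne_zero hz (by
    rw [← h.ofReal_re_det hz, h0, Complex.ofReal_zero])
  have h1 : ∀ {f : Cn n → ℝ}, DifferentiableAt ℝ f z → ∀ u,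
      fderiv ℝ (fun x => (f x : ℂ)) z u = (fderiv ℝ f z u : ℂ) := fun hf u => by
    simpa using fderiv_re_add_im hf (differentiableAt_const (0 : ℝ)) u
  have h2 : ∀ u, fderiv ℝ (fun x => ((Real.log (hermMat G x).det.re : ℝ) : ℂ)) z u
      = ∑ α, ∑ τ, (hermMat G z)⁻¹ τ α * fderiv ℝ (fun x => hermMat G x α τ) z u := by
    intro u
    have h3 := h1 hre u
    -- The determinant of a Hermitian matrix is real, so its real part may be replaced by the
    -- determinant itself before applying Jacobi's formula.
    rw [fderiv_congr_on h.isOpen (fun x hx => h.ofReal_re_det hx) hz,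
      fderiv_det (h.differentiableAt_hermMat hz)] at h3
    rw [h1 (hre.log hne), fderiv.log hre hne, _root_.smul_apply, smul_eq_mul, Complex.ofReal_mul,
      ← h3, Complex.ofReal_inv, h.ofReal_re_det hz, Finset.mul_sum, Finset.sum_comm]
    refine Finset.sum_congr rfl fun τ _ => ?_
    rw [Finset.mul_sum]
    refine Finset.sum_congr rfl fun α _ => ?_
    rw [Matrix.inv_def, Ring.inverse_eq_inv', Matrix.smul_apply, smul_eq_mul, mul_assoc]
  rw [wirt, h2, h2]
  simp only [christoffel, wirt, Finset.mul_sum, ← Finset.sum_sub_distrib]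
  exact Finset.sum_congr rfl fun _ _ => Finset.sum_congr rfl fun _ _ => by ring

lemma contDiffOn_log_det (h : LocalFinsler G U) :
    ContDiffOn ℝ ∞ (fun x => ((Real.log (hermMat G x).det.re : ℝ) : ℂ)) U := by
  have h1 : ContDiffOn ℝ ∞ (fun x => (hermMat G x).det.re) U :=
    Complex.reCLM.contDiff.comp_contDiffOn (contDiffOn_det h.contDiffOn_hermMat)
  exact Complex.ofRealCLM.contDiff.comp_contDiffOn (h1.log fun z hz h0 => h.det_ne_zero hz (by
    rw [← h.ofReal_re_det hz, h0, Complex.ofReal_zero]))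

lemma neg_wirt_wirtBar_log_det (h : LocalFinsler G U) {z : Cn n} (hz : z ∈ U) (μ ν : Fin n) :
    -wirt (cvec μ) (wirtBar (cvec ν) (fun x => ((Real.log (hermMat G x).det.re : ℝ) : ℂ))) z
      = ∑ α, -wirtBar (cvec ν) (christoffel G α α μ) z := by
  rw [wirt_wirtBar_comm h.isOpen h.contDiffOn_log_det hz,
    wirtBar_congr_on h.isOpen (fun x hx => h.wirt_log_det hx μ) hz,
    wirtBar_sum _ fun α _ => h.differentiableAt_christoffel hz α α μ, Finset.sum_neg_distrib]

end LocalFinsler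

/-! ### Finsler metrics on manifolds -/

section Manifold

variable {M : Type*} [TopologicalSpace M] [ChartedSpace (Cn n) M]
  {F : TangentBundle 𝓘(ℂ, Cn n) M → ℝ} {φ : OpenPartialHomeomorph M (Cn n)}

lemma mdifferentiable_of_mem_holCharts [IsManifold 𝓘(ℂ, Cn n) ω M] (hφ : φ ∈ holCharts n M) :
    φ.MDifferentiable 𝓘(ℂ, Cn n) 𝓘(ℂ, Cn n) :=
  ⟨(contMDiffOn_of_mem_maximalAtlas hφ).mdifferentiableOn (by simp),
    (contMDiffOn_symm_of_mem_maximalAtlas hφ).mdifferentiableOn (by simp)⟩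

lemma tvec_ne_zero [IsManifold 𝓘(ℂ, Cn n) ω M] (hφ : φ ∈ holCharts n M) {z v : Cn n}
    (hz : z ∈ φ.target) (hv : v ≠ 0) : tvec φ z v ≠ 0 := by
  intro h0
  have h1 := DFunLike.congr_fun ((mdifferentiable_of_mem_holCharts hφ).comp_symm_deriv hz) v
  change mfderiv 𝓘(ℂ, Cn n) 𝓘(ℂ, Cn n) φ (φ.symm z) (tvec φ z v) = v at h1
  rw [h0, map_zero] at h1
  exact hv h1.symm

/-- Of `∇𝐉 = 0` only the case of constant components is kept: the derivative terms then vanish and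
an algebraic identity for the connection forms remains. -/
lemma localFinsler [IsManifold 𝓘(ℂ, Cn n) ω M] (hF : IsStronglyConvexFinsler F)
    (hJ : CartanParallelJ F) (hφ : φ ∈ holCharts n M) :
    LocalFinsler (localG F φ) φ.target where
  isOpen := φ.open_target
  smooth := (hF.smooth φ hφ).pow 2
  homogeneous z _ v a := by
    have h1 : tvec φ z (a • v) = a • tvec φ z v := map_smul _ a v
    simp only [localG, localF, h1, hF.homogeneous, mul_pow]
  pos z hz v hv := pow_pos (hF.pos _ _ (tvec_ne_zero hφ hz hv)) 2
  posDef := hF.strongly_convex φ hφ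
  parallel p hp X Y := hJ φ hφ p hp X (fun _ => Y) contDiffAt_const

/-- The polarization of `F²` on the tangent spaces. -/
noncomputable def hermForm (F : TangentBundle 𝓘(ℂ, Cn n) M → ℝ) (p : M)
    (v w : TangentSpace 𝓘(ℂ, Cn n) p) : ℂ :=
  pol (fun u : TangentSpace 𝓘(ℂ, Cn n) p => F ⟨p, u⟩ ^ 2) v w

/-- Polarization commutes with complex linear maps, and `tvec φ z` is one; thus the local
computations describe a form defined without charts. -/
lemma hermComp_hermForm (z : Cn n) :
    hermComp (hermForm F) φ z = hermMat (localG F φ) z := by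
  ext α β
  have h1 : ∀ u w : Cn n, tvec φ z (u + w) = tvec φ z u + tvec φ z w := fun u w => map_add _ u w
  have h2 : ∀ u w : Cn n, tvec φ z (u - w) = tvec φ z u - tvec φ z w := fun u w => map_sub _ u w
  have h3 : ∀ u : Cn n, tvec φ z (Complex.I • u) = Complex.I • tvec φ z u :=
    fun u => map_smul _ Complex.I u
  simp only [hermComp, hermMat, polAt, hermForm, pol, localG, localF, h1, h2, h3, Matrix.of_apply]

lemma exists_invForm_tangentSpace [IsManifold 𝓘(ℂ, Cn n) ω M] (hF : IsStronglyConvexFinsler F)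
    (hJ : CartanParallelJ F) (p : M) :
    ∃ b : TangentSpace 𝓘(ℂ, Cn n) p → TangentSpace 𝓘(ℂ, Cn n) p → ℝ,
      IsInvForm b ∧ ∀ v, F ⟨p, v⟩ ^ 2 = b v v := by
  have hφ : chartAt (Cn n) p ∈ holCharts n M := IsManifold.chart_mem_maximalAtlas p
  set φ := chartAt (Cn n) p with hφ_def
  have hp : p ∈ φ.source := mem_chart_source (Cn n) p
  obtain ⟨b, hb, hQ, -⟩ := (localFinsler hF hJ hφ).exists_invForm (φ.map_source hp)
  let A : TangentSpace 𝓘(ℂ, Cn n) p →L[ℂ] Cn n := mfderiv 𝓘(ℂ, Cn n) 𝓘(ℂ, Cn n) φ p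
  refine ⟨fun u w => b (A u) (A w), ⟨fun u u' w => ?_, fun t u w => ?_, fun u w => hb.symm _ _,
    fun u w => ?_⟩, fun v => ?_⟩
  · rw [map_add, hb.add_left]
  · rw [map_smul, hb.smul_left]
  · rw [map_smul, map_smul, hb.inv]
  · beta_reduce
    rw [← hQ]
    have h1 : tvec φ (φ p) (A v) = v :=
      DFunLike.congr_fun ((mdifferentiable_of_mem_holCharts hφ).symm_comp_deriv hp) v
    -- All tangent spaces unfold to the model space; forgetting the dependence on the base point
    -- allows `φ.symm (φ p)` to be rewritten to `p`.
    let F' : M → Cn n → ℝ := fun q w => F ⟨q, w⟩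
    have h2 : F' (φ.symm (φ p)) (tvec φ (φ p) (A v)) = F' p v := by
      rw [h1, φ.left_inv hp]
    exact congrArg (· ^ 2) h2.symm

lemma isHermitianMetric_hermForm [IsManifold 𝓘(ℂ, Cn n) ω M] (hF : IsStronglyConvexFinsler F)
    (hJ : CartanParallelJ F) : IsHermitianMetric (hermForm F) where
  add_left p v v' w := by
    obtain ⟨b, hb, hQ⟩ := exists_invForm_tangentSpace hF hJ p
    exact hb.pol_add_left hQ v v' w
  smul_left p a v w := by
    obtain ⟨b, hb, hQ⟩ := exists_invForm_tangentSpace hF hJ p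
    exact hb.pol_smul_left hQ a v w
  conj_symm p v w := by
    obtain ⟨b, hb, hQ⟩ := exists_invForm_tangentSpace hF hJ p
    exact hb.pol_conj hQ v w
  pos p v hv := by
    obtain ⟨b, hb, hQ⟩ := exists_invForm_tangentSpace hF hJ p
    rw [hermForm, hb.pol_self hQ, Complex.ofReal_re]
    exact pow_pos (hF.pos p v hv) 2
  smooth φ hφ α β := by
    simp only [hermComp_hermForm]
    exact (localFinsler hF hJ hφ).contDiffOn_hermMat α β

end Manifold

end ComplexFinsler

/-! ### Assembly of the theorem -/

theorem theorem1p3 (n : ℕ) (M : Type*) [TopologicalSpace M]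
    [ChartedSpace (ComplexFinsler.Cn n) M]
    [IsManifold 𝓘(ℂ, ComplexFinsler.Cn n) ω M]
    (F : TangentBundle 𝓘(ℂ, ComplexFinsler.Cn n) M → ℝ)
    (hF : ComplexFinsler.IsStronglyConvexFinsler F)
    (hJ : ComplexFinsler.CartanParallelJ F)
    (c : ℝ) (hc : c ≠ 0) (hcurv : ComplexFinsler.HasConstHolSecCurv F c) :
    (∀ φ ∈ ComplexFinsler.holCharts n M, ∀ p ∈ ComplexFinsler.slit φ, ∀ μ ν : Fin n,
      ComplexFinsler.cMetric (ComplexFinsler.localG F φ) p μ ν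
        = 4 / ((c : ℂ) * ((n : ℂ) + 1))
          * ComplexFinsler.ricci (ComplexFinsler.localG F φ) μ ν p) ∧
    (∀ φ ∈ ComplexFinsler.holCharts n M, ∀ z ∈ φ.target,
      ∀ v w : ComplexFinsler.Cn n, v ≠ 0 → w ≠ 0 →
        ComplexFinsler.cMetric (ComplexFinsler.localG F φ) (z, v)
          = ComplexFinsler.cMetric (ComplexFinsler.localG F φ) (z, w)) ∧
    ComplexFinsler.IsKahlerEinstein F (c * ((n : ℝ) + 1) / 4) := by
  have hloc := fun φ hφ => ComplexFinsler.localFinsler (φ := φ) hF hJ hφ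
  refine ⟨fun φ hφ p hp μ ν => ?_, fun φ hφ z hz v w hv hw => ?_, ComplexFinsler.hermForm F,
    ComplexFinsler.isHermitianMetric_hermForm hF hJ, fun p v => ?_, fun φ hφ z hz α β γ => ?_,
    fun φ hφ z hz μ ν => ?_⟩
  · have h := hloc φ hφ
    have hn : (n : ℂ) + 1 ≠ 0 := Nat.cast_add_one_ne_zero n
    have hc' : (c : ℂ) ≠ 0 := Complex.ofReal_ne_zero.2 hc
    have h1 : ComplexFinsler.ricci (ComplexFinsler.localG F φ) μ ν p
        = ((c * ((n : ℝ) + 1) / 4 : ℝ) : ℂ)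
          * ComplexFinsler.hermMat (ComplexFinsler.localG F φ) p.1 μ ν := by
      rw [← h.ricci_of_constHolSecCurv (hcurv φ hφ) hp.1]
      exact Finset.sum_congr rfl fun α _ => by rw [h.dzBar_chernHor hp]
    rw [h1, h.cMetric_eq hp]
    push_cast
    field_simp
  · rw [(hloc φ hφ).cMetric_eq (p := (z, v)) ⟨hz, hv⟩,
      (hloc φ hφ).cMetric_eq (p := (z, w)) ⟨hz, hw⟩]
  · obtain ⟨b, hb, hQ⟩ := ComplexFinsler.exists_invForm_tangentSpace hF hJ p
    exact (hb.pol_self hQ v).symm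
  · simp only [ComplexFinsler.hermComp_hermForm]
    exact (hloc φ hφ).kahler_wirt hz α β γ
  · have h := hloc φ hφ
    simp only [ComplexFinsler.hermRicci, ComplexFinsler.hermComp_hermForm]
    rw [h.neg_wirt_wirtBar_log_det hz, h.ricci_of_constHolSecCurv (hcurv φ hφ) hz]
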